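/- Let $d\ge 1$, let $(\mathcal S,\|\cdot\|)$ be a real normed space with its Borel $\sigma$-algebra, and let $\mathcal M$ be the set of point measures $\gamma=\sum_i\delta_{(x_i,m_i)}$ on $\mathbb R^d\times\mathcal S$ such that $\gamma(\Lambda\times\mathcal S)<\infty$ for every bounded $\Lambda\subset\mathbb R^d$, with the $\sigma$-algebra generated by the counting maps $\gamma\mapsto\gamma(\Lambda\times A)$ ($\Lambda$ bounded Borel, $A$ Borel). Let $\mathcal M_f\subset\mathcal M$ be the set of finite point measures, write $\gamma_\Lambda$ for the restriction of $\gamma$ to $\Lambda\times\mathcal S$, $\langle\gamma,f\rangle=\int f\,d\gamma$, and $\theta_a$ for the translation $(x,m)\mapsto(x+a,m)$ acting on $\mathcal M$. Put $\Lambda_n=[-n,n)^d$. Let $R$ be a probability measure on $\mathcal S$, $z>0$ and $\delta>0$, and assume $\int e^{\|m\|^{d+2\delta}}R(dm)<\infty$. Let $\pi^z$ be the Poisson point process on $\mathbb R^d\times\mathcal S$ with intensity measure $z\,dx\otimes R(dm)$, and $\pi^z_\Lambda$ the Poisson point process with intensity measure $z\,\mathbf 1_\Lambda(x)\,dx\otimes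 R(dm)$. Let $H:\mathcal M_f\to\mathbb R\cup\{+\infty\}$ be measurable and invariant under all translations $\theta_a$, $a\in\mathbb R^d$, with $H(0)=0$ for the zero measure $0$, and assume that for some $c\ge 0$ $$H(\gamma)\ \ge\ -c\,\langle\gamma,1+\|m\|^{d+\delta}\rangle\qquad\text{for all }\gamma\in\mathcal M_f .$$ For $n\ge1$ let $P_n(d\gamma)=Z_{\Lambda_n}^{-1}e^{-H(\gamma_{\Lambda_n})}\pi^z_{\Lambda_n}(d\gamma)$, where $Z_{\Lambda_n}=\int e^{-H(\gamma_{\Lambda_n})}\,\pi^z_{\Lambda_n}(d\gamma)$, be the finite-volume Gibbs measure with free boundary condition; let $\tilde P_n$ be the law under which the configurations in the disjoint blocks $\Lambda_n+2n\kappa$, $\kappa\in\mathbb Z^d$, are independent and distributed as $P_n$ (shifted by $2n\kappa$); and let $$\bar P_n=\frac1{(2n)^d}\sum_{\kappa\in\Lambda_n\cap\mathbb Z^d}\tilde P_n\circ\theta_\kappa^{-1}.$$ For probability measures $Q,Q'$ on $\mathcal M$ with images $Q_\Lambda,Q'_\Lambda$ under $\gamma\mapsto\gamma_\Lambda$, let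 $I_\Lambda(Q|Q')=\int\log\frac{dQ_\Lambda}{dQ'_\Lambda}\,dQ_\Lambda$ if $Q_\Lambda\ll Q'_\Lambda$, and $+\infty$ otherwise, and let $\mathscr I(Q|Q')=\lim_{N\to\infty}|\Lambda_N|^{-1}I_{\Lambda_N}(Q|Q')$ be the specific entropy. Then there is a constant $a_3>0$ such that for all $n\ge1$, $\bar P_n$ is a well-defined probability measure on $\mathcal M$, the limit defining $\mathscr I(\bar P_n|\pi^z)$ exists, and $$\mathscr I(\bar P_n|\pi^z)\le a_3 .$$ -/

import Mathlib

open MeasureTheory Set Filter Topology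
open scoped ENNReal

noncomputable section

namespace MarkedGibbs

set_option linter.unusedSectionVars false

/-- The location space `ℝ^d` with its Euclidean norm. -/
abbrev Loc (d : ℕ) : Type := EuclideanSpace ℝ (Fin d)

/-- The half-open cube `[a, b)^d`. -/
def box (d : ℕ) (a b : ℝ) : Set (Loc d) := {x | ∀ i, a ≤ x i ∧ x i < b}

/-- The cube `Λ_n = [-n, n)^d`. -/
def cube (d n : ℕ) : Set (Loc d) := box d (-n) n

/-- The lattice point `κ ∈ ℤ^d`, seen as a vector of `ℝ^d`. -/
def latticeVec {d : ℕ} (κ : Fin d → ℤ) : Loc d := WithLp.toLp 2 fun i => (κ i : ℝ)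

lemma isBounded_cube (d n : ℕ) : Bornology.IsBounded (cube d n) := by
  have h : cube d n ⊆ Metric.closedBall 0 (Real.sqrt (∑ _i : Fin d, (n : ℝ) ^ 2)) := by
    intro x hx
    rw [mem_closedBall_zero_iff, EuclideanSpace.norm_eq]
    apply Real.sqrt_le_sqrt
    apply Finset.sum_le_sum
    intro i _
    have := hx i
    rw [Real.norm_eq_abs]
    exact pow_le_pow_left₀ (abs_nonneg _) (abs_le.2 ⟨this.1, this.2.le⟩) 2
  exact Metric.isBounded_closedBall.subset h

lemma measurableSet_box (d : ℕ) (a b : ℝ) : MeasurableSet (box d a b) := by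
  have : box d a b = ⋂ i, {x : Loc d | a ≤ x i ∧ x i < b} := by
    ext x; simp [box]
  rw [this]
  refine MeasurableSet.iInter fun i => ?_
  have hm : Measurable fun x : Loc d => x i := by fun_prop
  exact (measurableSet_le measurable_const hm).inter (measurableSet_lt hm measurable_const)

section Configurations

variable {d : ℕ} {S : Type*} [MeasurableSpace S]

/-- Point measures on `ℝ^d × S`: countable sums of Dirac masses (multiplicities are allowed)
with finite mass on `Λ × S` for every bounded `Λ ⊆ ℝ^d`. -/
def IsPointMeasure (γ : Measure (Loc d × S)) : Prop :=
  (∃ (ι : Type) (_ : Countable ι) (x : ι → Loc d × S),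
      γ = Measure.sum fun i => Measure.dirac (x i)) ∧
    ∀ Λ : Set (Loc d), Bornology.IsBounded Λ → γ (Λ ×ˢ univ) < ∞

variable (d S) in
/-- The space `𝓜` of point measures. -/
def Config : Type _ := {γ : Measure (Loc d × S) // IsPointMeasure γ}

/-- The `σ`-algebra on `𝓜`, generated by the evaluations `γ ↦ γ B`, `B` measurable; by
`config_measurableSpace_eq` this is the one generated by the local counting functions. -/
instance : MeasurableSpace (Config d S) := Subtype.instMeasurableSpace

variable (d S) in
/-- The space `𝓜_f` of finite point measures. -/
def FinConfig : Type _ := {γ : Config d S // γ.1 univ < ∞}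

instance : MeasurableSpace (FinConfig d S) := Subtype.instMeasurableSpace

lemma measurable_config_iff {Ω : Type*} [MeasurableSpace Ω] {f : Ω → Config d S} :
    Measurable f ↔ ∀ B, MeasurableSet B → Measurable fun ω => (f ω).1 B := by
  constructor
  · intro h B hB
    exact (Measure.measurable_coe hB).comp (measurable_subtype_coe.comp h)
  · intro h
    exact (Measure.measurable_of_measurable_coe _ h).subtype_mk

lemma measurable_eval {B : Set (Loc d × S)} (hB : MeasurableSet B) :
    Measurable fun γ : Config d S => γ.1 B :=
  measurable_config_iff.1 measurable_id B hB

lemma config_measurableSpace_eq :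
    (inferInstance : MeasurableSpace (Config d S)) =
      ⨆ (Λ : Set (Loc d)) (_ : MeasurableSet Λ) (_ : Bornology.IsBounded Λ)
        (A : Set S) (_ : MeasurableSet A),
        MeasurableSpace.comap (fun γ : Config d S => γ.1 (Λ ×ˢ A)) inferInstance := by
  apply le_antisymm
  · set m : MeasurableSpace (Config d S) :=
      ⨆ (Λ : Set (Loc d)) (_ : MeasurableSet Λ) (_ : Bornology.IsBounded Λ)
        (A : Set S) (_ : MeasurableSet A),
        MeasurableSpace.comap (fun γ : Config d S => γ.1 (Λ ×ˢ A)) inferInstance with hm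
    have h0 : ∀ (Λ : Set (Loc d)) (A : Set S), MeasurableSet Λ → Bornology.IsBounded Λ →
        MeasurableSet A → Measurable[m] (fun γ : Config d S => γ.1 (Λ ×ˢ A)) := by
      intro Λ A h1 h2 h3
      rw [measurable_iff_comap_le, hm]
      exact le_iSup_of_le Λ (le_iSup_of_le h1 (le_iSup_of_le h2
        (le_iSup_of_le A (le_iSup_of_le h3 le_rfl))))
    -- restrictions to a ball
    have h1 : ∀ (r : ℕ) (B : Set (Loc d × S)), MeasurableSet B →
        Measurable[m] (fun γ : Config d S =>
          (γ.1.restrict (Metric.ball 0 (r : ℝ) ×ˢ univ)) B) := by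
      intro r
      have hball : MeasurableSet (Metric.ball (0 : Loc d) (r : ℝ) ×ˢ (univ : Set S)) :=
        measurableSet_ball.prod MeasurableSet.univ
      have huniv : Measurable[m] (fun γ : Config d S =>
          (γ.1.restrict (Metric.ball 0 (r : ℝ) ×ˢ univ)) univ) := by
        simp only [Measure.restrict_apply_univ]
        exact h0 _ _ measurableSet_ball Metric.isBounded_ball MeasurableSet.univ
      intro B hB
      induction B, hB using MeasurableSpace.induction_on_inter
        (generateFrom_prod.symm) isPiSystem_prod with
      | empty => simp
      | basic t ht =>
        obtain ⟨Λ, hΛ, A, hA, rfl⟩ := ht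
        have hΛ : MeasurableSet Λ := hΛ
        have hA : MeasurableSet A := hA
        have : ∀ γ : Config d S, (γ.1.restrict (Metric.ball 0 (r : ℝ) ×ˢ univ)) (Λ ×ˢ A) =
            γ.1 ((Λ ∩ Metric.ball 0 (r : ℝ)) ×ˢ A) := by
          intro γ
          rw [Measure.restrict_apply (MeasurableSet.prod hΛ hA), prod_inter_prod, inter_univ]
        simp only [this]
        exact h0 _ _ (MeasurableSet.inter hΛ measurableSet_ball)
          (Metric.isBounded_ball.subset inter_subset_right) hA
      | compl t ht ih =>
        have : ∀ γ : Config d S, (γ.1.restrict (Metric.ball 0 (r : ℝ) ×ˢ univ)) tᶜ =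
            (γ.1.restrict (Metric.ball 0 (r : ℝ) ×ˢ univ)) univ -
              (γ.1.restrict (Metric.ball 0 (r : ℝ) ×ˢ univ)) t := by
          intro γ
          refine measure_compl ht (ne_top_of_le_ne_top ?_ (measure_mono (subset_univ t)))
          rw [Measure.restrict_apply_univ]
          exact (γ.2.2 _ Metric.isBounded_ball).ne
        simp only [this]
        exact huniv.sub ih
      | iUnion f hd hf ih =>
        have : ∀ γ : Config d S, (γ.1.restrict (Metric.ball 0 (r : ℝ) ×ˢ univ)) (⋃ i, f i) =
            ∑' i, (γ.1.restrict (Metric.ball 0 (r : ℝ) ×ˢ univ)) (f i) :=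
          fun γ => measure_iUnion hd hf
        simp only [this]
        exact Measurable.tsum ih
    have h2 : Measurable[m] (fun γ : Config d S => γ.1) := by
      refine @Measure.measurable_of_measurable_coe _ _ _ m _ fun B hB => ?_
      have : ∀ γ : Config d S, γ.1 B =
          ⨆ r : ℕ, (γ.1.restrict (Metric.ball 0 (r : ℝ) ×ˢ univ)) B := by
        intro γ
        have hu : B = ⋃ r : ℕ, (B ∩ (Metric.ball (0 : Loc d) (r : ℝ) ×ˢ (univ : Set S))) := by
          rw [← inter_iUnion, ← iUnion_prod_const, Metric.iUnion_ball_nat, univ_prod_univ,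
            inter_univ]
        conv_lhs => rw [hu]
        rw [Monotone.measure_iUnion]
        · simp only [Measure.restrict_apply hB]
        · intro a b hab
          refine inter_subset_inter_right _ (prod_mono_left (Metric.ball_subset_ball ?_))
          exact_mod_cast hab
      simp only [this]
      exact Measurable.iSup fun r => h1 r B hB
    exact measurable_iff_comap_le.1 h2
  · refine iSup_le fun Λ => iSup_le fun h1 => iSup_le fun _ => iSup_le fun A => iSup_le fun h3 => ?_
    exact measurable_iff_comap_le.1 (measurable_eval (MeasurableSet.prod h1 h3))

/-- The configuration `∑_{i<k} δ_{x_i}`. -/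
def ofPoints {k : ℕ} (x : Fin k → Loc d × S) : Config d S :=
  ⟨Measure.sum fun i => Measure.dirac (x i), ⟨Fin k, inferInstance, x, rfl⟩, fun Λ _ => by
    rw [Measure.sum_apply_of_countable, tsum_fintype]
    exact ENNReal.sum_lt_top.2 fun i _ => measure_lt_top _ _⟩

lemma measurable_ofPoints {k : ℕ} :
    Measurable (ofPoints : (Fin k → Loc d × S) → Config d S) := by
  refine measurable_config_iff.2 fun B hB => ?_
  have : ∀ x : Fin k → Loc d × S, (ofPoints x).1 B = ∑ i, B.indicator 1 (x i) := by
    intro x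
    simp only [ofPoints]
    rw [Measure.sum_apply _ hB, tsum_fintype]
    exact Finset.sum_congr rfl fun i _ => Measure.dirac_apply' _ hB
  simp only [this]
  exact Finset.measurable_sum _ fun i _ =>
    (measurable_one.indicator hB).comp (measurable_pi_apply i)

/-- The empty configuration. -/
def emptyConfig : Config d S := ofPoints (k := 0) Fin.elim0

lemma emptyConfig_univ : (emptyConfig : Config d S).1 univ < ∞ := by
  simp [emptyConfig, ofPoints]

/-- The translation `θ_a` acting on configurations: `(x, m) ↦ (x + a, m)` on every point. -/
def translate (a : Loc d) (γ : Config d S) : Config d S :=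
  ⟨γ.1.map (Prod.map (· + a) id), by
    have hmeas : Measurable (Prod.map (· + a) id : Loc d × S → Loc d × S) :=
      (measurable_add_const a).prodMap measurable_id
    obtain ⟨⟨ι, hι, x, hx⟩, hfin⟩ := γ.2
    refine ⟨⟨ι, hι, fun i => Prod.map (· + a) id (x i), ?_⟩, fun Λ hΛ => ?_⟩
    · rw [hx, Measure.map_sum hmeas.aemeasurable]
      simp only [Measure.map_dirac' hmeas]
    · obtain ⟨r, hr⟩ := hΛ.subset_closedBall 0
      have hb : MeasurableSet (Metric.closedBall (0 : Loc d) r ×ˢ (univ : Set S)) :=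
        measurableSet_closedBall.prod MeasurableSet.univ
      refine (measure_mono (prod_mono_left hr)).trans_lt ?_
      rw [Measure.map_apply hmeas hb]
      refine (measure_mono ?_).trans_lt
        (hfin (Metric.closedBall (-a) r) Metric.isBounded_closedBall)
      rintro ⟨y, m⟩ hy
      simpa [dist_eq_norm] using hy⟩

lemma measurable_translate (a : Loc d) :
    Measurable (translate a : Config d S → Config d S) := by
  have hmeas : Measurable (Prod.map (· + a) id : Loc d × S → Loc d × S) :=
    (measurable_add_const a).prodMap measurable_id
  exact ((Measure.measurable_map _ hmeas).comp measurable_subtype_coe).subtype_mk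

/-- The translation acting on finite configurations. -/
def FinConfig.translate (a : Loc d) (γ : FinConfig d S) : FinConfig d S :=
  ⟨MarkedGibbs.translate a γ.1, by
    have hmeas : Measurable (Prod.map (· + a) id : Loc d × S → Loc d × S) :=
      (measurable_add_const a).prodMap measurable_id
    simpa [MarkedGibbs.translate, Measure.map_apply hmeas MeasurableSet.univ] using γ.2⟩

variable [MeasurableSingletonClass S]

/-- The restriction `γ_Λ` of `γ` to `Λ × S`. -/
def restrict (Λ : Set (Loc d)) (γ : Config d S) : Config d S :=
  ⟨γ.1.restrict (Λ ×ˢ univ), by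
    classical
    obtain ⟨⟨ι, hι, x, hx⟩, hfin⟩ := γ.2
    refine ⟨⟨{i // x i ∈ Λ ×ˢ (univ : Set S)}, inferInstance, fun i => x i, ?_⟩, fun Δ hΔ =>
      (Measure.restrict_apply_le _ _).trans_lt (hfin Δ hΔ)⟩
    rw [hx, Measure.restrict_sum_of_countable]
    ext B hB
    rw [Measure.sum_apply _ hB, Measure.sum_apply _ hB]
    refine Eq.trans ?_
      (tsum_subtype {i | x i ∈ Λ ×ˢ (univ : Set S)} fun i => Measure.dirac (x i) B).symm
    refine tsum_congr fun i => ?_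
    rw [restrict_dirac]
    by_cases h : x i ∈ Λ ×ˢ (univ : Set S)
    · rw [if_pos h, indicator_of_mem (by exact h)]
    · rw [if_neg h, indicator_of_notMem (by exact h)]; rfl⟩

lemma measurable_restrict {Λ : Set (Loc d)} (hΛ : MeasurableSet Λ) :
    Measurable (restrict Λ : Config d S → Config d S) := by
  refine measurable_config_iff.2 fun B hB => ?_
  simp only [restrict, Measure.restrict_apply hB]
  exact measurable_eval (hB.inter (hΛ.prod MeasurableSet.univ))

/-- The restriction `γ_Λ` to a bounded `Λ`, as a finite configuration. -/
def restrictFin (Λ : Set (Loc d)) (hΛ : Bornology.IsBounded Λ) (γ : Config d S) :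
    FinConfig d S :=
  ⟨restrict Λ γ, by simpa [restrict] using γ.2.2 Λ hΛ⟩

/-- Given one configuration `γ_κ` for every `κ ∈ ℤ^d`, the configuration whose part in the block
`[a, b)^d + (b - a)κ` is the copy of `γ_κ ∩ [a, b)^d` shifted by `(b - a)κ`. -/
def glue (a b : ℝ) (γ : (Fin d → ℤ) → Config d S) : Config d S :=
  ⟨Measure.sum fun κ => (translate ((b - a) • latticeVec κ) (restrict (box d a b) (γ κ))).1, by
    constructor
    · choose ι hι x hx using fun κ =>
        (translate ((b - a) • latticeVec κ) (restrict (box d a b) (γ κ))).2.1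
      refine ⟨Σ κ, ι κ, inferInstance, fun p => x p.1 p.2, ?_⟩
      simp only [hx]
      ext B hB
      simp only [Measure.sum_apply _ hB]
      exact (ENNReal.tsum_sigma fun κ i => Measure.dirac (x κ i) B).symm
    · intro Λ hΛ
      obtain ⟨r, hr⟩ := hΛ.subset_closedBall 0
      set K : ℝ := (|a| + |b| + r) / (b - a) with hK
      have hfin : {κ : Fin d → ℤ | ∀ i, |(κ i : ℝ)| ≤ K}.Finite := by
        refine (Set.finite_Icc (fun _ => -⌈K⌉) fun _ => ⌈K⌉).subset ?_
        intro κ hκ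
        refine ⟨fun i => ?_, fun i => ?_⟩ <;>
        · have h1 := abs_le.1 (hκ i)
          have h2 := Int.le_ceil K
          have h3 : (-(⌈K⌉ : ℤ) : ℝ) ≤ (κ i : ℝ) := by linarith
          have h4 : (κ i : ℝ) ≤ (⌈K⌉ : ℤ) := by linarith
          first | exact_mod_cast h3 | exact_mod_cast h4
      rw [Measure.sum_apply_of_countable, tsum_eq_sum (s := hfin.toFinset)]
      · exact ENNReal.sum_lt_top.2 fun κ _ => Subtype.property
          (translate ((b - a) • latticeVec κ) (restrict (box d a b) (γ κ))) |>.2 Λ hΛ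
      · intro κ hκ
        have hb : MeasurableSet (Metric.closedBall (0 : Loc d) r ×ˢ (univ : Set S)) :=
          measurableSet_closedBall.prod MeasurableSet.univ
        have hmeas : Measurable
            (Prod.map (· + (b - a) • latticeVec κ) id : Loc d × S → Loc d × S) :=
          (measurable_add_const _).prodMap measurable_id
        refine measure_mono_null (prod_mono_left hr) ?_
        simp only [translate, restrict]
        rw [Measure.map_apply hmeas hb, Measure.restrict_apply (hmeas hb)]
        convert measure_empty (μ := (γ κ).1)
        rw [eq_empty_iff_forall_notMem]
        rintro ⟨y, m⟩ ⟨hy1, hy2⟩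
        apply hκ
        rw [Set.Finite.mem_toFinset]
        intro i
        have hc := (hy2.1 : y ∈ box d a b) i
        have hn : 0 < b - a := by linarith [hc.1, hc.2]
        have hnorm : ‖y + (b - a) • latticeVec κ‖ ≤ r := by simpa using hy1
        have hi := (PiLp.norm_apply_le (y + (b - a) • latticeVec κ) i).trans hnorm
        have hi' : |y i + (b - a) * (κ i : ℝ)| ≤ r := by
          simpa [latticeVec] using hi
        have h1 := abs_le.1 hi'
        have h0 : |(b - a) * (κ i : ℝ)| ≤ |a| + |b| + r :=
          abs_le.2 ⟨by linarith [le_abs_self b, abs_nonneg a],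
            by linarith [neg_abs_le a, abs_nonneg b]⟩
        rw [abs_mul, abs_of_pos hn] at h0
        rw [hK, le_div_iff₀ hn]
        linarith⟩

lemma measurable_glue (a b : ℝ) :
    Measurable (glue a b : ((Fin d → ℤ) → Config d S) → Config d S) := by
  refine measurable_config_iff.2 fun B hB => ?_
  simp only [glue, Measure.sum_apply _ hB]
  refine Measurable.tsum fun κ => ?_
  exact (measurable_eval hB).comp ((measurable_translate _).comp
    ((measurable_restrict (measurableSet_box d a b)).comp (measurable_pi_apply κ)))

end Configurations

section Laws

variable {d : ℕ} {S : Type*} [MeasurableSpace S]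

/-- The law of the Poisson point process with finite intensity measure `μ`: the number of points
is Poisson with parameter `μ(E)` and, given this number, the points are independent with law
`μ / μ(E)`; that is, `∑_k e^{-μ(E)} / k! · (law of ∑_{i<k} δ_{x_i} under μ^{⊗k})`. -/
def poissonLaw (μ : Measure (Loc d × S)) : Measure (Config d S) :=
  Measure.sum fun k : ℕ =>
    (ENNReal.ofReal (Real.exp (-(μ univ).toReal)) / (k.factorial : ℝ≥0∞)) •
      (Measure.pi fun _ : Fin k => μ).map ofPoints

/-- The marked Poisson process `π^z_Λ` in `Λ`, with intensity measure `z dx_Λ ⊗ R(dm)`. -/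
def poissonIn (z : ℝ) (R : Measure S) (Λ : Set (Loc d)) : Measure (Config d S) :=
  poissonLaw (ENNReal.ofReal z • (volume.restrict Λ).prod R)

variable [MeasurableSingletonClass S]

/-- The law of the configuration whose parts in the blocks `[a, b)^d + (b - a)κ`, `κ ∈ ℤ^d`, are
independent copies (up to the shift by `(b - a)κ`) of a configuration in `[a, b)^d` with law `P`.
The product measure, hence this measure, is `0` if `P` is not a probability measure. -/
def blockField (a b : ℝ) (P : Measure (Config d S)) : Measure (Config d S) :=
  (Measure.infinitePi fun _ : Fin d → ℤ => P).map (glue a b)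

variable (d) in
/-- The marked Poisson process `π^z` on `ℝ^d × S`, with intensity measure `z dx ⊗ R(dm)`: the
superposition of independent Poisson processes in the disjoint unit cubes `[0, 1)^d + κ`. -/
def poissonProcess (z : ℝ) (R : Measure S) : Measure (Config d S) :=
  blockField 0 1 (poissonIn z R (box d 0 1))

/-- The partition function `Z_Λ = ∫ e^{-H(γ_Λ)} π^z_Λ(dγ)`. -/
def partitionFunction (H : FinConfig d S → EReal) (z : ℝ) (R : Measure S) (Λ : Set (Loc d))
    (hΛ : Bornology.IsBounded Λ) : ℝ≥0∞ :=
  ∫⁻ γ, EReal.exp (-H (restrictFin Λ hΛ γ)) ∂(poissonIn z R Λ)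

/-- The finite-volume Gibbs measure `P_Λ(dγ) = Z_Λ⁻¹ e^{-H(γ_Λ)} π^z_Λ(dγ)` with free boundary
condition. -/
def gibbs (H : FinConfig d S → EReal) (z : ℝ) (R : Measure S) (Λ : Set (Loc d))
    (hΛ : Bornology.IsBounded Λ) : Measure (Config d S) :=
  (partitionFunction H z R Λ hΛ)⁻¹ •
    (poissonIn z R Λ).withDensity fun γ => EReal.exp (-H (restrictFin Λ hΛ γ))

/-- The measure `P̃_n`: independent copies of `P_n = P_{Λ_n}` in the blocks `Λ_n + 2nκ`. -/
def gibbsTilde (H : FinConfig d S → EReal) (z : ℝ) (R : Measure S) (n : ℕ) :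
    Measure (Config d S) :=
  blockField (-n) n (gibbs H z R (cube d n) (isBounded_cube d n))

/-- The empirical field `P̄_n = (2n)^{-d} ∑_{κ ∈ Λ_n ∩ ℤ^d} P̃_n ∘ θ_κ⁻¹`. -/
def gibbsBar (H : FinConfig d S → EReal) (z : ℝ) (R : Measure S) (n : ℕ) :
    Measure (Config d S) :=
  ((2 * n : ℝ≥0∞) ^ d)⁻¹ •
    ∑ κ ∈ Fintype.piFinset fun _ : Fin d => Finset.Ico (-(n : ℤ)) n,
      (gibbsTilde H z R n).map (translate (latticeVec κ))

/-- The relative entropy `I_Λ(Q | Q')`, that is `∫ log (dQ_Λ/dQ'_Λ) dQ_Λ` if `Q_Λ ≪ Q'_Λ` and `∞`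
otherwise (for probability measures this is Mathlib's Kullback–Leibler divergence). -/
def relEntropy (Λ : Set (Loc d)) (Q Q' : Measure (Config d S)) : ℝ≥0∞ :=
  InformationTheory.klDiv (Q.map (restrict Λ)) (Q'.map (restrict Λ))

/-- The limit `𝓘(Q | Q') = lim_N |Λ_N|⁻¹ I_{Λ_N}(Q | Q')` exists and is equal to `s`. -/
def HasSpecificEntropy (Q Q' : Measure (Config d S)) (s : ℝ≥0∞) : Prop :=
  Tendsto (fun N : ℕ => relEntropy (cube d N) Q Q' / volume (cube d N)) atTop (𝓝 s)

end Laws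

section Assumptions

variable {d : ℕ} {S : Type*} [NormedAddCommGroup S] [MeasurableSpace S]

/-- Energy functionals: measurable, translation-invariant maps `H : 𝓜_f → ℝ ∪ {+∞}` which vanish
at the empty configuration. -/
structure IsEnergy (H : FinConfig d S → EReal) : Prop where
  measurable : Measurable H
  ne_bot : ∀ γ, H γ ≠ ⊥
  translate_eq : ∀ (a : Loc d) (γ : FinConfig d S), H (γ.translate a) = H γ
  empty_eq : H ⟨emptyConfig, emptyConfig_univ⟩ = 0

/-- The mark assumption: the image `ρ` of `R` under the norm has a super-exponential moment,
`∫ e^{ℓ^{d+2δ}} ρ(dℓ) < ∞`. -/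
def MarkMoment (d : ℕ) (δ : ℝ) (R : Measure S) : Prop :=
  ∫⁻ ℓ : ℝ, ENNReal.ofReal (Real.exp (ℓ ^ ((d : ℝ) + 2 * δ))) ∂(R.map fun m => ‖m‖) < ∞

/-- The stability assumption: `H(γ) ≥ -c ⟨γ, 1 + ‖m‖^{d+δ}⟩` for all finite `γ`, for some
`c ≥ 0`. -/
def IsStable (δ : ℝ) (H : FinConfig d S → EReal) : Prop :=
  ∃ c : ℝ, 0 ≤ c ∧ ∀ γ : FinConfig d S,
    ((-(c * ∫ p, (1 + ‖p.2‖ ^ ((d : ℝ) + δ)) ∂γ.1.1) : ℝ) : EReal) ≤ H γ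

end Assumptions

end MarkedGibbs

end

open MarkedGibbs

/-! The estimate is made in a single block. By stability, `e^{-H}` is at most the exponential of the
additive functional `c ⟨γ, 1 + ‖m‖^{d+δ}⟩`, so its second moment is bounded by an exponential moment
of a Poisson process. That moment is explicit, and it is finite because `‖m‖^{d+2δ}` eventually
dominates any multiple of `‖m‖^{d+δ}`. The empty configuration alone gives `Z ≥ e^{-z|Λ|}`. Hence
the density of `P_n` has second moment at most `A = e^{z(1+M)|Λ|}`, where `M = ∫ e^{2c(1+‖m‖^{d+δ})}
dR`. The inequality `t log t ≤ t log A + t²/A` then bounds the relative entropy of `P_n` by `2 +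
z(1+M)|Λ|` (`klDiv_withDensity_le`, `klDiv_gibbs_le`).

To pass to the specific entropy, the reference process must be compatible with every position of the
grid of blocks. Characteristic functionals show that independent Poisson processes in the blocks of
any translated grid superpose to the same process (`poissonProcess_eq_map_translate`). Relative to
it, a shifted copy of `P̃_n` is a product measure block by block. Let `I` be the relative entropy in
one block. Data processing shows that the entropy in a window `Λ_N` is at most `I` times the number
of blocks in a lattice cube covering the window, and at least `I` times the number in a lattice cube
contained in it (`relEntropy_blockField_le`, `le_relEntropy_blockField`). Both numbers are
asymptotic to `|Λ_N| / |Λ_n|`.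

Relative entropy is convex under the average over the `(2n)^d` lattice shifts, and concave up to an
error `log (2n)^d`. This error does not depend on `N` and disappears after division by `|Λ_N|`. The
limit therefore exists and equals `I / |Λ_n|` (`hasSpecificEntropy_average`), which is bounded
uniformly in `n` because `|Λ_n| ≥ 1`. -/

namespace MarkedGibbs

set_option linter.unusedSectionVars false

/-! ### Relative entropy: products, second-moment bound, mixtures -/

section KullbackLeibler

open InformationTheory

variable {α β : Type*} [MeasurableSpace α] [MeasurableSpace β]

/-- Data processing applied to `e` and to its inverse. -/
lemma klDiv_map_measurableEquiv (e : α ≃ᵐ β) (μ ν : Measure α) [IsFiniteMeasure μ]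
    [IsFiniteMeasure ν] : klDiv (μ.map e) (ν.map e) = klDiv μ ν := by
  refine le_antisymm (klDiv_map_le (μ := μ) (ν := ν) (hg := e.measurable)) ?_
  have h := klDiv_map_le (μ := μ.map e) (ν := ν.map e) (hg := e.symm.measurable)
  simpa [Measure.map_map e.symm.measurable e.measurable] using h

/-- The chain rule with constant kernels leaves the divergence of two products sharing the first
factor `μ₁`. After swapping coordinates, the common kernel drops out. -/
lemma klDiv_prod (μ₁ ν₁ : Measure α) (μ₂ ν₂ : Measure β) [IsProbabilityMeasure μ₁]
    [IsProbabilityMeasure ν₁] [IsProbabilityMeasure μ₂] [IsProbabilityMeasure ν₂] :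
    klDiv (μ₁.prod μ₂) (ν₁.prod ν₂) = klDiv μ₁ ν₁ + klDiv μ₂ ν₂ := by
  have h1 := klDiv_compProd_eq_add (μ := μ₁) (ν := ν₁) (κ := ProbabilityTheory.Kernel.const α μ₂)
    (η := ProbabilityTheory.Kernel.const α ν₂)
  have h2 := klDiv_compProd_left (μ := μ₂) (ν := ν₂) (κ := ProbabilityTheory.Kernel.const β μ₁)
  simp only [Measure.compProd_const] at h1 h2
  have h3 := klDiv_map_measurableEquiv (MeasurableEquiv.prodComm (α := β) (β := α))
    (μ₂.prod μ₁) (ν₂.prod μ₁)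
  have e : ⇑(MeasurableEquiv.prodComm (α := β) (β := α)) = Prod.swap := rfl
  rw [e, Measure.prod_swap, Measure.prod_swap] at h3
  rw [h1, h3, h2]

lemma klDiv_pi_fin (k : ℕ) (μ ν : Measure α) [IsProbabilityMeasure μ] [IsProbabilityMeasure ν] :
    klDiv (Measure.pi fun _ : Fin k => μ) (Measure.pi fun _ : Fin k => ν) = k * klDiv μ ν := by
  induction k with
  | zero =>
    have h : (Measure.pi fun _ : Fin 0 => μ) = Measure.pi fun _ : Fin 0 => ν := by
      rw [Measure.pi_of_empty, Measure.pi_of_empty]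
    simp [h]
  | succ k ih =>
    have hμ := (measurePreserving_piFinSuccAbove (fun _ : Fin (k + 1) => μ) 0).map_eq
    have hν := (measurePreserving_piFinSuccAbove (fun _ : Fin (k + 1) => ν) 0).map_eq
    rw [← klDiv_map_measurableEquiv (MeasurableEquiv.piFinSuccAbove (fun _ => α) 0), hμ, hν,
      klDiv_prod, ih]
    push_cast
    ring

lemma klDiv_pi {ι : Type*} [Fintype ι] (μ ν : Measure α) [IsProbabilityMeasure μ]
    [IsProbabilityMeasure ν] :
    klDiv (Measure.pi fun _ : ι => μ) (Measure.pi fun _ : ι => ν) =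
      Fintype.card ι * klDiv μ ν := by
  let e : Fin (Fintype.card ι) ≃ ι := (Fintype.equivFin ι).symm
  have hμ := (measurePreserving_piCongrLeft (fun _ : ι => μ) e).map_eq
  have hν := (measurePreserving_piCongrLeft (fun _ : ι => ν) e).map_eq
  rw [← hμ, ← hν, klDiv_map_measurableEquiv, klDiv_pi_fin]

lemma klDiv_withDensity (P : Measure α) [IsFiniteMeasure P] {f : α → ℝ≥0∞} (hf : Measurable f)
    (hfi : ∫⁻ x, f x ∂P ≠ ∞) :
    klDiv (P.withDensity f) P = ∫⁻ x, ENNReal.ofReal (klFun (f x).toReal) ∂P := by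
  have := isFiniteMeasure_withDensity hfi
  rw [klDiv_eq_lintegral_klFun_of_ac (withDensity_absolutelyContinuous _ _)]
  refine lintegral_congr_ae ?_
  filter_upwards [Measure.rnDeriv_withDensity P hf] with x hx
  rw [hx]

/-- Only the logarithm of the second moment enters, so a second moment exponential in the volume
yields an entropy linear in the volume. -/
lemma klDiv_withDensity_le (P : Measure α) [IsProbabilityMeasure P] {f : α → ℝ≥0∞}
    (hf : Measurable f) (hf1 : ∫⁻ x, f x ∂P = 1) {A : ℝ} (hA : 1 ≤ A)
    (hfA : ∫⁻ x, f x ^ 2 ∂P ≤ ENNReal.ofReal A) :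
    klDiv (P.withDensity f) P ≤ ENNReal.ofReal (2 + Real.log A) := by
  rw [klDiv_withDensity P hf (by simp [hf1])]
  have hA0 : 0 < A := by linarith
  have hl : 0 ≤ Real.log A := Real.log_nonneg hA
  calc ∫⁻ x, ENNReal.ofReal (klFun (f x).toReal) ∂P
      ≤ ∫⁻ x, (1 + (ENNReal.ofReal (Real.log A) * f x + (ENNReal.ofReal A)⁻¹ * f x ^ 2)) ∂P := by
        refine lintegral_mono_ae ?_
        filter_upwards [ae_lt_top hf (by simp [hf1] : ∫⁻ x, f x ∂P ≠ ∞)] with x hx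
        lift f x to NNReal using hx.ne with t ht
        have h0 : (0 : ℝ) ≤ t := t.2
        -- This is `log (t / A) ≤ t / A - 1` multiplied by `t`, with the favourable linear terms
        -- dropped. The case `t = 0` is separate because of the logarithm.
        have key : klFun t ≤ 1 + (Real.log A * t + A⁻¹ * (t : ℝ) ^ 2) := by
          rw [klFun_apply]
          rcases h0.eq_or_lt with h | h
          · rw [← h]; simp
          · have h1 : Real.log (t / A) ≤ t / A - 1 := Real.log_le_sub_one_of_pos (by positivity)
            rw [Real.log_div h.ne' hA0.ne'] at h1
            have h2 : (t : ℝ) * Real.log t ≤ t * (Real.log A + t / A) :=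
              mul_le_mul_of_nonneg_left (by linarith) h0
            have h3 : (t : ℝ) * (Real.log A + t / A) = Real.log A * t + A⁻¹ * (t : ℝ) ^ 2 := by
              field_simp
            linarith
        refine (ENNReal.ofReal_le_ofReal key).trans_eq ?_
        rw [ENNReal.ofReal_add zero_le_one (by positivity),
          ENNReal.ofReal_add (by positivity) (by positivity), ENNReal.ofReal_mul hl,
          ENNReal.ofReal_mul (by positivity), ENNReal.ofReal_inv_of_pos hA0,
          ENNReal.ofReal_pow h0, ENNReal.ofReal_one, ENNReal.ofReal_coe_nnreal]
    _ ≤ 1 + (ENNReal.ofReal (Real.log A) * 1 + (ENNReal.ofReal A)⁻¹ * ENNReal.ofReal A) := by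
        rw [lintegral_add_left measurable_const, lintegral_add_left (by fun_prop),
          lintegral_const_mul _ hf, lintegral_const_mul _ (by fun_prop), hf1]
        simp only [lintegral_const, measure_univ, mul_one]
        gcongr
    _ ≤ ENNReal.ofReal (2 + Real.log A) := by
        rw [ENNReal.inv_mul_cancel (by simpa using hA0) ENNReal.ofReal_ne_top, mul_one,
          ENNReal.ofReal_add zero_le_two hl]
        simp only [ENNReal.ofReal_ofNat]
        rw [← one_add_one_eq_two]
        exact le_of_eq (by ring)

lemma sum_withDensity {ι : Type*} (s : Finset ι) (P : Measure α) {f : ι → α → ℝ≥0∞}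
    (hf : ∀ i, Measurable (f i)) :
    ∑ i ∈ s, P.withDensity (f i) = P.withDensity fun x => ∑ i ∈ s, f i x := by
  ext B hB
  simp only [Measure.coe_finsetSum, Finset.sum_apply, withDensity_apply _ hB]
  rw [lintegral_finsetSum _ fun i _ => hf i]

lemma klFun_average_le {ι : Type*} {s : Finset ι} (hs : s.Nonempty) {x : ι → ℝ}
    (hx : ∀ i, 0 ≤ x i) :
    klFun ((s.card : ℝ)⁻¹ * ∑ i ∈ s, x i) ≤ (s.card : ℝ)⁻¹ * ∑ i ∈ s, klFun (x i) := by
  have hc : (s.card : ℝ) ≠ 0 := by simpa using hs.ne_empty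
  have := convexOn_klFun.map_sum_le (t := s) (w := fun _ => (s.card : ℝ)⁻¹) (p := x)
    (fun _ _ => by positivity) (by simp [hc]) (fun i _ => hx i)
  simpa [Finset.mul_sum] using this

/-- Each `x i` is at most the whole sum `s.card * m`, hence `log (x i) ≤ log s.card + log m`.
Averaging against the weights `x i` costs exactly `m * log s.card`. -/
lemma average_klFun_le {ι : Type*} {s : Finset ι} (hs : s.Nonempty) {x : ι → ℝ}
    (hx : ∀ i, 0 ≤ x i) :
    (s.card : ℝ)⁻¹ * ∑ i ∈ s, klFun (x i) ≤ klFun ((s.card : ℝ)⁻¹ * ∑ i ∈ s, x i) +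
      Real.log s.card * ((s.card : ℝ)⁻¹ * ∑ i ∈ s, x i) := by
  have hc0 : (0 : ℝ) < s.card := by exact_mod_cast hs.card_pos
  set m : ℝ := (s.card : ℝ)⁻¹ * ∑ i ∈ s, x i with hm
  have hsum : ∑ i ∈ s, x i = s.card * m := by rw [hm, mul_inv_cancel_left₀ hc0.ne']
  clear_value m
  clear hm
  have h1 : ∀ i ∈ s, klFun (x i) ≤ x i * (Real.log s.card + Real.log m) + 1 - x i := by
    intro i hi
    rw [klFun_apply]
    rcases (hx i).eq_or_lt with h | h
    · simp [← h]
    · have hle : x i ≤ s.card * m := hsum ▸ Finset.single_le_sum (fun j _ => hx j) hi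
      -- The logarithm of the product splits only for `m ≠ 0`, which holds as soon as one term is
      -- positive.
      have hm0 : 0 < m := by
        by_contra hcon
        nlinarith
      rw [← Real.log_mul hc0.ne' hm0.ne']
      have := mul_le_mul_of_nonneg_left (Real.log_le_log h hle) h.le
      linarith
  calc (s.card : ℝ)⁻¹ * ∑ i ∈ s, klFun (x i)
      ≤ (s.card : ℝ)⁻¹ * ∑ i ∈ s, (x i * (Real.log s.card + Real.log m) + 1 - x i) := by
        gcongr with i hi; exact h1 i hi
    _ = klFun m + Real.log s.card * m := by
        rw [Finset.sum_sub_distrib, Finset.sum_add_distrib, ← Finset.sum_mul, hsum, klFun_apply]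
        simp only [Finset.sum_const, nsmul_eq_mul, mul_one]
        field_simp
        ring

lemma average_withDensity {ι : Type*} (s : Finset ι) (P : Measure α) (c : ℝ≥0∞)
    {Q : ι → Measure α} [SigmaFinite P] [∀ i, SigmaFinite (Q i)] (hQ : ∀ i, Q i ≪ P) :
    c • ∑ i ∈ s, Q i = P.withDensity fun x => c * ∑ i ∈ s, (Q i).rnDeriv P x := by
  have h : ∀ i, Q i = P.withDensity ((Q i).rnDeriv P) := fun i =>
    (Measure.withDensity_rnDeriv_eq _ _ (hQ i)).symm
  conv_lhs => enter [2, 2, i]; rw [h i]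
  rw [sum_withDensity s P fun i => Measure.measurable_rnDeriv _ _]
  exact (withDensity_smul c (Finset.measurable_fun_sum s fun i _ =>
    Measure.measurable_rnDeriv _ _)).symm

section Average

variable {ι : Type*} {s : Finset ι} {P : Measure α} [IsProbabilityMeasure P]
  {Q : ι → Measure α} [∀ i, IsProbabilityMeasure (Q i)]

lemma lintegral_average_rnDeriv (hs : s.Nonempty) (hQ : ∀ i, Q i ≪ P) :
    ∫⁻ x, (s.card : ℝ≥0∞)⁻¹ * ∑ i ∈ s, (Q i).rnDeriv P x ∂P = 1 := by
  rw [lintegral_const_mul _ (Finset.measurable_fun_sum s fun i _ =>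
    Measure.measurable_rnDeriv _ _), lintegral_finsetSum _ fun i _ =>
    Measure.measurable_rnDeriv _ _]
  simp only [Measure.lintegral_rnDeriv (hQ _), measure_univ, Finset.sum_const, nsmul_eq_mul,
    mul_one]
  exact ENNReal.inv_mul_cancel (by simpa using hs.ne_empty) (by simp)

lemma klDiv_average (hs : s.Nonempty) (hQ : ∀ i, Q i ≪ P) :
    klDiv ((s.card : ℝ≥0∞)⁻¹ • ∑ i ∈ s, Q i) P =
      ∫⁻ x, ENNReal.ofReal (klFun ((s.card : ℝ)⁻¹ * ∑ i ∈ s, ((Q i).rnDeriv P x).toReal)) ∂P := by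
  rw [average_withDensity s P _ hQ, klDiv_withDensity P]
  · refine lintegral_congr_ae ?_
    have : ∀ᵐ x ∂P, ∀ i ∈ s, (Q i).rnDeriv P x < ∞ :=
      (ae_ball_iff s.countable_toSet).2 fun i _ => Measure.rnDeriv_lt_top _ _
    filter_upwards [this] with x hx
    rw [ENNReal.toReal_mul, ENNReal.toReal_sum fun i hi => (hx i hi).ne]
    simp
  · exact (Finset.measurable_fun_sum s fun i _ => Measure.measurable_rnDeriv _ _).const_mul _
  · simp [lintegral_average_rnDeriv hs hQ]

lemma average_klDiv (hs : s.Nonempty) (hQ : ∀ i, Q i ≪ P) :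
    (s.card : ℝ≥0∞)⁻¹ * ∑ i ∈ s, klDiv (Q i) P =
      ∫⁻ x, ENNReal.ofReal ((s.card : ℝ)⁻¹ * ∑ i ∈ s, klFun ((Q i).rnDeriv P x).toReal) ∂P := by
  have hm : ∀ i, Measurable fun x => ENNReal.ofReal (klFun ((Q i).rnDeriv P x).toReal) :=
    fun i => by fun_prop
  simp only [klDiv_eq_lintegral_klFun_of_ac (hQ _)]
  rw [← lintegral_finsetSum _ fun i _ => hm i,
    ← lintegral_const_mul _ (Finset.measurable_fun_sum s fun i _ => hm i)]
  refine lintegral_congr fun x => ?_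
  have hc0 : (0 : ℝ) < s.card := by exact_mod_cast hs.card_pos
  rw [ENNReal.ofReal_mul (by positivity), ENNReal.ofReal_sum_of_nonneg fun i _ =>
    klFun_nonneg ENNReal.toReal_nonneg, ENNReal.ofReal_inv_of_pos hc0, ENNReal.ofReal_natCast]

/-- The relative entropy is convex in its first argument. -/
lemma klDiv_average_le (hs : s.Nonempty) (hQ : ∀ i, Q i ≪ P) :
    klDiv ((s.card : ℝ≥0∞)⁻¹ • ∑ i ∈ s, Q i) P ≤
      (s.card : ℝ≥0∞)⁻¹ * ∑ i ∈ s, klDiv (Q i) P := by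
  rw [klDiv_average hs hQ, average_klDiv hs hQ]
  exact lintegral_mono fun x => ENNReal.ofReal_le_ofReal
    (klFun_average_le hs fun i => ENNReal.toReal_nonneg)

/-- The relative entropy is concave in its first argument up to the entropy of the weights. -/
lemma average_klDiv_le (hs : s.Nonempty) (hQ : ∀ i, Q i ≪ P) :
    (s.card : ℝ≥0∞)⁻¹ * ∑ i ∈ s, klDiv (Q i) P ≤
      klDiv ((s.card : ℝ≥0∞)⁻¹ • ∑ i ∈ s, Q i) P + ENNReal.ofReal (Real.log s.card) := by
  have hc0 : (0 : ℝ) < s.card := by exact_mod_cast hs.card_pos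
  have hl : 0 ≤ Real.log s.card := Real.log_nonneg (by exact_mod_cast hs.card_pos)
  have hsum : Measurable fun x => ∑ i ∈ s, (Q i).rnDeriv P x :=
    Finset.measurable_fun_sum s fun i _ => Measure.measurable_rnDeriv _ _
  rw [klDiv_average hs hQ, average_klDiv hs hQ]
  calc _ ≤ ∫⁻ x, (ENNReal.ofReal (klFun ((s.card : ℝ)⁻¹ * ∑ i ∈ s, ((Q i).rnDeriv P x).toReal)) +
        ENNReal.ofReal (Real.log s.card) *
          ((s.card : ℝ≥0∞)⁻¹ * ∑ i ∈ s, (Q i).rnDeriv P x)) ∂P := by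
        refine lintegral_mono fun x => ?_
        have hnn : 0 ≤ (s.card : ℝ)⁻¹ * ∑ i ∈ s, ((Q i).rnDeriv P x).toReal :=
          mul_nonneg (by positivity) (Finset.sum_nonneg fun i _ => ENNReal.toReal_nonneg)
        refine (ENNReal.ofReal_le_ofReal
          (average_klFun_le hs fun i => ENNReal.toReal_nonneg)).trans ?_
        rw [ENNReal.ofReal_add (klFun_nonneg hnn) (by positivity), ENNReal.ofReal_mul hl,
          ENNReal.ofReal_mul (by positivity), ENNReal.ofReal_inv_of_pos hc0,
          ENNReal.ofReal_natCast, ENNReal.ofReal_sum_of_nonneg fun i _ => ENNReal.toReal_nonneg]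
        gcongr
        exact ENNReal.ofReal_toReal_le
    _ = _ := by
        rw [lintegral_add_right _ (by fun_prop), lintegral_const_mul _ (by fun_prop),
          lintegral_average_rnDeriv hs hQ, mul_one]

end Average

end KullbackLeibler

/-! ### Characteristic functionals determine laws of configurations -/

section CharacteristicFunctional

variable {d : ℕ} {S : Type*} [MeasurableSpace S]

/-- Bounded measurable functions on `ℝ^d × S` vanishing outside `Λ × S` for some bounded `Λ`. -/
structure IsTestFunction (f : Loc d × S → ℝ) : Prop where
  measurable : Measurable f
  bounded : ∃ C, ∀ p, ‖f p‖ ≤ C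
  local_support : ∃ r : ℝ, ∀ p, r < ‖p.1‖ → f p = 0

lemma IsTestFunction.integrable {f : Loc d × S → ℝ} (hf : IsTestFunction f)
    {μ : Measure (Loc d × S)}
    (hμ : ∀ Λ : Set (Loc d), Bornology.IsBounded Λ → μ (Λ ×ˢ univ) < ∞) : Integrable f μ := by
  obtain ⟨C, hC⟩ := hf.bounded
  obtain ⟨r, hr⟩ := hf.local_support
  have hs : Function.support f ⊆ Metric.closedBall (0 : Loc d) r ×ˢ (univ : Set S) := by
    intro p hp
    refine ⟨?_, mem_univ _⟩
    rw [mem_closedBall_zero_iff]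
    by_contra h
    exact hp (hr p (not_le.1 h))
  rw [← integrableOn_iff_integrable_of_support_subset hs]
  exact Measure.integrableOn_of_bounded (hμ _ Metric.isBounded_closedBall).ne
    hf.measurable.aestronglyMeasurable (M := C) (ae_of_all _ hC)

lemma IsTestFunction.measurable_integral {f : Loc d × S → ℝ} (hf : IsTestFunction f) :
    Measurable fun γ : Config d S => ∫ p, f p ∂γ.1 := by
  have h : ∀ γ : Config d S, ∫ p, f p ∂γ.1 =
      (∫⁻ p, ENNReal.ofReal (f p) ∂γ.1).toReal - (∫⁻ p, ENNReal.ofReal (-f p) ∂γ.1).toReal :=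
    fun γ => integral_eq_lintegral_pos_part_sub_lintegral_neg_part (hf.integrable γ.2.2)
  simp only [h]
  have hg : ∀ g : Loc d × S → ℝ≥0∞, Measurable g →
      Measurable fun γ : Config d S => ∫⁻ p, g p ∂γ.1 := fun g hg =>
    (Measure.measurable_lintegral hg).comp measurable_subtype_coe
  exact (hg _ hf.measurable.ennreal_ofReal).ennreal_toReal.sub
    (hg _ hf.measurable.neg.ennreal_ofReal).ennreal_toReal

/-- The exponential `exp(i ⟨γ, f⟩)`. -/
noncomputable def charExp (f : Loc d × S → ℝ) (γ : Config d S) : ℂ :=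
  Complex.exp ((∫ p, f p ∂γ.1 : ℝ) * Complex.I)

lemma norm_charExp (f : Loc d × S → ℝ) (γ : Config d S) : ‖charExp f γ‖ = 1 :=
  Complex.norm_exp_ofReal_mul_I _

lemma IsTestFunction.measurable_charExp {f : Loc d × S → ℝ} (hf : IsTestFunction f) :
    Measurable (charExp f : Config d S → ℂ) := by
  have := hf.measurable_integral
  unfold charExp
  fun_prop

lemma IsTestFunction.integrable_charExp {f : Loc d × S → ℝ} (hf : IsTestFunction f)
    (Q : Measure (Config d S)) [IsFiniteMeasure Q] : Integrable (charExp f) Q :=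
  Integrable.of_bound hf.measurable_charExp.aestronglyMeasurable 1
    (ae_of_all _ fun γ => (norm_charExp f γ).le)

variable (d S) in
/-- The index set of the local counting functions. -/
abbrev CountingSet : Type _ :=
  {B : Set (Loc d) × Set S // MeasurableSet B.1 ∧ Bornology.IsBounded B.1 ∧ MeasurableSet B.2}

/-- The family of all local counting functions. -/
noncomputable def counts (γ : Config d S) (B : CountingSet d S) : ℝ :=
  (γ.1 (B.1.1 ×ˢ B.1.2)).toReal

lemma measurable_counts : Measurable (counts : Config d S → CountingSet d S → ℝ) :=
  measurable_pi_lambda _ fun B =>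
    (measurable_eval (B.2.1.prod B.2.2.2)).ennreal_toReal

/-- Counts over bounded sets are finite, so passing to real values loses no information. Laws on
configurations can thus be compared as laws on a product of real lines. -/
lemma measurableSpace_eq_comap_counts :
    (inferInstance : MeasurableSpace (Config d S)) =
      MeasurableSpace.comap counts (inferInstance : MeasurableSpace (CountingSet d S → ℝ)) := by
  refine le_antisymm ?_ measurable_counts.comap_le
  rw [config_measurableSpace_eq]
  refine iSup_le fun Λ => iSup_le fun h1 => iSup_le fun h2 => iSup_le fun A => iSup_le fun h3 => ?_
  rw [← measurable_iff_comap_le]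
  have h : (fun γ : Config d S => γ.1 (Λ ×ˢ A)) =
      fun γ => ENNReal.ofReal (counts γ ⟨(Λ, A), h1, h2, h3⟩) := by
    funext γ
    refine (ENNReal.ofReal_toReal (ne_top_of_le_ne_top (γ.2.2 Λ h2).ne ?_)).symm
    exact measure_mono (prod_mono_right (subset_univ _))
  rw [h]
  exact ((measurable_pi_apply _).comp (comap_measurable counts)).ennreal_ofReal

/-- Integrating such step functions against `γ` produces every linear combination of finitely many
counts, which is what identifies the finite-dimensional distributions. -/
lemma isTestFunction_sum {J : Type*} [Fintype J] (B : J → CountingSet d S) (t : J → ℝ) :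
    IsTestFunction fun p : Loc d × S =>
      ∑ j, t j * ((B j).1.1 ×ˢ (B j).1.2).indicator (fun _ => (1 : ℝ)) p where
  measurable := Finset.measurable_fun_sum _ fun j _ =>
    (measurable_const.indicator ((B j).2.1.prod (B j).2.2.2)).const_mul _
  bounded := by
    refine ⟨∑ j, |t j|, fun p => (norm_sum_le _ _).trans (Finset.sum_le_sum fun j _ => ?_)⟩
    rw [norm_mul, Real.norm_eq_abs]
    refine mul_le_of_le_one_right (abs_nonneg _) ?_
    exact (norm_indicator_le_norm_self _ _).trans (by simp)
  local_support := by
    have hb : Bornology.IsBounded (⋃ j, (B j).1.1) :=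
      (Bornology.isBounded_iUnion).2 fun j => (B j).2.2.1
    obtain ⟨r, hr⟩ := hb.subset_closedBall 0
    refine ⟨r, fun p hp => Finset.sum_eq_zero fun j _ => ?_⟩
    rw [indicator_of_notMem, mul_zero]
    intro h
    have := hr (mem_iUnion.2 ⟨j, h.1⟩)
    rw [mem_closedBall_zero_iff] at this
    linarith

lemma integral_sum_indicator {J : Type*} [Fintype J] (B : J → CountingSet d S) (t : J → ℝ)
    (γ : Config d S) :
    ∫ p, ∑ j, t j * ((B j).1.1 ×ˢ (B j).1.2).indicator (fun _ => (1 : ℝ)) p ∂γ.1 =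
      ∑ j, counts γ (B j) * t j := by
  have hm : ∀ j, MeasurableSet ((B j).1.1 ×ˢ (B j).1.2) := fun j => (B j).2.1.prod (B j).2.2.2
  have hlt : ∀ j, γ.1 ((B j).1.1 ×ˢ (B j).1.2) ≠ ∞ := fun j =>
    ne_top_of_le_ne_top (γ.2.2 _ (B j).2.2.1).ne (measure_mono (prod_mono_right (subset_univ _)))
  rw [integral_finsetSum]
  · refine Finset.sum_congr rfl fun j _ => ?_
    rw [integral_const_mul, integral_indicator_const _ (hm j)]
    simp [counts, Measure.real, mul_comm]
  · intro j _
    exact ((integrable_indicator_iff (hm j)).2 (integrableOn_const (hlt j))).const_mul _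

/-- A probability measure on configurations is determined by its characteristic functional. -/
theorem ext_of_charFunctional {Q Q' : Measure (Config d S)} [IsProbabilityMeasure Q]
    [IsProbabilityMeasure Q']
    (h : ∀ f : Loc d × S → ℝ, IsTestFunction f →
      ∫ γ, charExp f γ ∂Q = ∫ γ, charExp f γ ∂Q') : Q = Q' := by
  have hp : Measurable (counts : Config d S → CountingSet d S → ℝ) := measurable_counts
  have key : Q.map counts = Q'.map counts := by
    have := Measure.isProbabilityMeasure_map (μ := Q) hp.aemeasurable
    have := Measure.isProbabilityMeasure_map (μ := Q') hp.aemeasurable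
    -- A finite measure on the product is determined by its finite-dimensional marginals, and each
    -- of these by its characteristic function.
    refine IsProjectiveLimit.unique (P := fun J => (Q'.map counts).map J.restrict)
      (fun J => ?_) (fun J => rfl)
    have hJ : Measurable (J.restrict : (CountingSet d S → ℝ) → (J → ℝ)) :=
      Finset.measurable_restrict J
    have := Measure.isProbabilityMeasure_map (μ := Q.map counts) hJ.aemeasurable
    have := Measure.isProbabilityMeasure_map (μ := Q'.map counts) hJ.aemeasurable
    refine Measure.ext_of_charFunDual (funext fun L => ?_)
    -- A linear form on `ℝ^J` has coefficients `L (Pi.single j 1)`. Evaluated on the counts, it is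
    -- the integral of the corresponding step function.
    have hL : ∀ P : Measure (Config d S), charFunDual ((P.map counts).map J.restrict) L =
        ∫ γ, charExp (fun p => ∑ j : J, L (Pi.single j 1) *
          (j.1.1.1 ×ˢ j.1.1.2).indicator (fun _ => (1 : ℝ)) p) γ ∂P := by
      intro P
      rw [charFunDual_apply, Measure.map_map hJ hp, integral_map (hJ.comp hp).aemeasurable
        (by fun_prop)]
      refine integral_congr_ae (ae_of_all _ fun γ => ?_)
      have e := LinearMap.pi_apply_eq_sum_univ L.toLinearMap (J.restrict (counts γ))
      simp only [charExp]
      rw [integral_sum_indicator (fun j : J => j.1)]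
      simp only [ContinuousLinearMap.coe_coe, smul_eq_mul] at e
      simp only [Function.comp]
      rw [e]
      congr 4
      funext j
      congr 2
      funext i
      simp [Pi.single_apply, eq_comm]
    rw [hL, hL]
    exact h _ (isTestFunction_sum (fun j : J => j.1) _)
  ext s hs
  obtain ⟨t, ht, rfl⟩ := (measurableSpace_eq_comap_counts (d := d) (S := S)).le s hs
  rw [← Measure.map_apply hp ht, ← Measure.map_apply hp ht, key]

end CharacteristicFunctional

/-! ### Exponential moments and characteristic functional of a Poisson process -/

section Poisson

variable {d : ℕ} {S : Type*} [MeasurableSpace S]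

lemma integral_ofPoints {k : ℕ} (x : Fin k → Loc d × S) {f : Loc d × S → ℝ} (hf : Measurable f) :
    ∫ p, f p ∂(ofPoints x).1 = ∑ i, f (x i) := by
  simp only [ofPoints, Measure.sum_fintype]
  rw [integral_finsetSum_measure]
  · exact Finset.sum_congr rfl fun i _ => integral_dirac' _ _ hf.stronglyMeasurable
  · intro i _
    exact integrable_dirac' hf.stronglyMeasurable (by simp)

lemma lintegral_ofPoints {k : ℕ} (x : Fin k → Loc d × S) {f : Loc d × S → ℝ≥0∞}
    (hf : Measurable f) : ∫⁻ p, f p ∂(ofPoints x).1 = ∑ i, f (x i) := by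
  simp only [ofPoints, lintegral_sum_measure, lintegral_dirac' _ hf, tsum_fintype]

lemma charExp_ofPoints {k : ℕ} (x : Fin k → Loc d × S) {f : Loc d × S → ℝ} (hf : Measurable f) :
    charExp f (ofPoints x) = ∏ i, Complex.exp (f (x i) * Complex.I) := by
  rw [charExp, integral_ofPoints x hf, ← Complex.exp_sum]
  push_cast
  rw [Finset.sum_mul]

lemma lintegral_pi_prod_fin {α : Type*} [MeasurableSpace α] (k : ℕ) (μ : Measure α)
    [SigmaFinite μ] {φ : α → ℝ≥0∞} (hφ : Measurable φ) :
    ∫⁻ x : Fin k → α, ∏ i, φ (x i) ∂(Measure.pi fun _ => μ) = (∫⁻ a, φ a ∂μ) ^ k := by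
  induction k with
  | zero => simp
  | succ k ih =>
    have h := (measurePreserving_piFinSuccAbove (fun _ : Fin (k + 1) => μ) 0).symm
    have hp : Measurable fun x : Fin (k + 1) → α => ∏ i, φ (x i) :=
      Finset.measurable_fun_prod _ fun i _ => hφ.comp (measurable_pi_apply i)
    rw [← h.lintegral_comp hp]
    have e : ∀ y : α × (Fin k → α),
        ∏ i, φ ((MeasurableEquiv.piFinSuccAbove (fun _ : Fin (k + 1) => α) 0).symm y i) =
          φ y.1 * ∏ i, φ (y.2 i) := by
      intro y
      rw [Fin.prod_univ_succ]
      simp [MeasurableEquiv.piFinSuccAbove]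
    simp only [e]
    have hk : Measurable fun x : Fin k → α => ∏ i, φ (x i) :=
      Finset.measurable_fun_prod _ fun i _ => hφ.comp (measurable_pi_apply i)
    rw [lintegral_prod_mul hφ.aemeasurable hk.aemeasurable, ih, pow_succ']

variable (μ : Measure (Loc d × S))

lemma lintegral_poissonLaw {g : Config d S → ℝ≥0∞} (hg : Measurable g) :
    ∫⁻ γ, g γ ∂(poissonLaw μ) = ∑' k : ℕ,
      (ENNReal.ofReal (Real.exp (-(μ univ).toReal)) / (k.factorial : ℝ≥0∞)) *
        ∫⁻ x : Fin k → Loc d × S, g (ofPoints x) ∂(Measure.pi fun _ => μ) := by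
  rw [poissonLaw, lintegral_sum_measure]
  refine tsum_congr fun k => ?_
  rw [lintegral_smul_measure, lintegral_map hg measurable_ofPoints, smul_eq_mul]

lemma tsum_exp_div_factorial {m a : ℝ} (ha : 0 ≤ a) :
    ∑' k : ℕ, (ENNReal.ofReal (Real.exp (-m)) / (k.factorial : ℝ≥0∞)) * ENNReal.ofReal a ^ k =
      ENNReal.ofReal (Real.exp (a - m)) := by
  have hs : HasSum (fun k : ℕ => Real.exp (-m) * (a ^ k / k.factorial))
      (Real.exp (-m) * Real.exp a) := by
    have := NormedSpace.expSeries_div_hasSum_exp a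
    rw [← Real.exp_eq_exp_ℝ] at this
    exact this.mul_left _
  rw [← Real.exp_add, neg_add_eq_sub] at hs
  rw [← hs.tsum_eq, ENNReal.ofReal_tsum_of_nonneg (fun k => by positivity) hs.summable]
  refine tsum_congr fun k => ?_
  rw [ENNReal.ofReal_mul (Real.exp_nonneg _), ENNReal.ofReal_div_of_pos (by positivity),
    ENNReal.ofReal_pow ha, ENNReal.ofReal_natCast]
  simp only [ENNReal.div_eq_inv_mul]
  ring

/-- The exponential moments of a Poisson point process. -/
lemma lintegral_exp_poissonLaw [IsFiniteMeasure μ] {f : Loc d × S → ℝ≥0∞} (hf : Measurable f)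
    (hfi : ∫⁻ p, EReal.exp (f p) ∂μ ≠ ∞) :
    ∫⁻ γ, EReal.exp ((∫⁻ p, f p ∂γ.1 : ℝ≥0∞) : EReal) ∂(poissonLaw μ) =
      ENNReal.ofReal (Real.exp ((∫⁻ p, EReal.exp (f p) ∂μ).toReal - (μ univ).toReal)) := by
  have hm : Measurable fun p => EReal.exp (f p : EReal) :=
    EReal.measurable_exp.comp (measurable_coe_ennreal_ereal.comp hf)
  have hF : Measurable fun γ : Config d S => ∫⁻ p, f p ∂γ.1 :=
    (Measure.measurable_lintegral hf).comp measurable_subtype_coe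
  have hE : Measurable fun γ : Config d S =>
      EReal.exp ((∫⁻ p, f p ∂γ.1 : ℝ≥0∞) : EReal) :=
    EReal.measurable_exp.comp (measurable_coe_ennreal_ereal.comp hF)
  rw [lintegral_poissonLaw μ hE,
    ← tsum_exp_div_factorial ENNReal.toReal_nonneg, ENNReal.ofReal_toReal hfi]
  -- Given `k` points, the exponential of the additive functional is a product over independent
  -- points. The sum over `k` is then an exponential series.
  refine tsum_congr fun k => ?_
  rw [← lintegral_pi_prod_fin k μ hm]
  congr 1
  refine lintegral_congr fun x => ?_
  rw [lintegral_ofPoints x hf]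
  generalize (Finset.univ : Finset (Fin k)) = s
  classical
  induction s using Finset.induction_on with
  | empty => simp
  | insert i s hi ih =>
    rw [Finset.sum_insert hi, Finset.prod_insert hi, EReal.coe_ennreal_add, EReal.exp_add, ih]

/-- The exponential moment formula with `f = 0`. -/
instance isProbabilityMeasure_poissonLaw [IsFiniteMeasure μ] :
    IsProbabilityMeasure (poissonLaw μ) := by
  constructor
  have h := lintegral_exp_poissonLaw μ (f := fun _ => 0) measurable_const (by simp)
  simpa using h

/-- The characteristic functional of a Poisson point process. -/
lemma integral_charExp_poissonLaw [IsFiniteMeasure μ] {f : Loc d × S → ℝ}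
    (hf : IsTestFunction f) :
    ∫ γ, charExp f γ ∂(poissonLaw μ) =
      Complex.exp (∫ p, (Complex.exp (f p * Complex.I) - 1) ∂μ) := by
  have hint := hf.integrable_charExp (poissonLaw μ)
  have hme := hf.measurable
  have hexp : Integrable (fun p => Complex.exp (f p * Complex.I)) μ :=
    Integrable.of_bound (by fun_prop) 1
      (ae_of_all _ fun p => (Complex.norm_exp_ofReal_mul_I _).le)
  -- The term with `k` points contributes the `k`-th power of this complex integral. The prefactor
  -- `e^{-μ(univ)}` accounts for the `-1` in the exponent.
  have hser := NormedSpace.expSeries_div_hasSum_exp (∫ p, Complex.exp (f p * Complex.I) ∂μ)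
  rw [← Complex.exp_eq_exp_ℂ] at hser
  rw [poissonLaw] at hint ⊢
  rw [integral_sum_measure hint, integral_sub hexp (integrable_const _), sub_eq_neg_add,
    Complex.exp_add, ← hser.tsum_eq, ← tsum_mul_left]
  refine tsum_congr fun k => ?_
  rw [integral_smul_measure, integral_map measurable_ofPoints.aemeasurable
    hf.measurable_charExp.aestronglyMeasurable]
  simp only [charExp_ofPoints _ hf.measurable]
  rw [integral_fintype_prod_eq_pow (fun p => Complex.exp (f p * Complex.I))]
  rw [ENNReal.toReal_div, ENNReal.toReal_ofReal (Real.exp_nonneg _), Fintype.card_fin]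
  simp only [ENNReal.toReal_natCast, integral_const, Measure.real, Complex.real_smul,
    Complex.ofReal_div, Complex.ofReal_exp, Complex.ofReal_natCast, Complex.ofReal_neg, mul_one]
  ring

end Poisson

/-! ### Block decomposition of space and of the intensity measure -/

section Blocks

variable {d : ℕ} {S : Type*} [MeasurableSpace S]

lemma isBounded_box (d : ℕ) (a b : ℝ) : Bornology.IsBounded (box d a b) := by
  obtain ⟨n, hn⟩ := exists_nat_ge (max |a| |b|)
  refine (isBounded_cube d n).subset fun x hx i => ⟨?_, ?_⟩
  · exact (neg_le_neg (((le_max_left _ _).trans hn))).trans ((neg_abs_le a).trans (hx i).1)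
  · exact (hx i).2.trans_le ((le_abs_self b).trans ((le_max_right _ _).trans hn))

variable (S) in
/-- The translation of `ℝ^d × S` by a vector of `ℝ^d`. -/
def shift (v : Loc d) : Loc d × S ≃ᵐ Loc d × S :=
  (MeasurableEquiv.addRight v).prodCongr (MeasurableEquiv.refl S)

@[simp] lemma shift_apply (v : Loc d) (p : Loc d × S) : shift S v p = (p.1 + v, p.2) := rfl

lemma translate_val (v : Loc d) (γ : Config d S) : (translate v γ).1 = γ.1.map (shift S v) := rfl

/-- The intensity measure `z dx ⊗ R(dm)`. -/
noncomputable def intensity (d : ℕ) (z : ℝ) (R : Measure S) : Measure (Loc d × S) :=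
  ENNReal.ofReal z • (volume : Measure (Loc d)).prod R

lemma measurePreserving_shift (v : Loc d) (z : ℝ) (R : Measure S) [SFinite R] :
    MeasurePreserving (shift S v) (intensity d z R) (intensity d z R) :=
  ((measurePreserving_add_right volume v).prod (MeasurePreserving.id R)).smul_measure _

lemma intensity_lt_top (z : ℝ) (R : Measure S) [IsFiniteMeasure R] (Λ : Set (Loc d))
    (hΛ : Bornology.IsBounded Λ) : intensity d z R (Λ ×ˢ univ) < ∞ := by
  rw [intensity, Measure.smul_apply, Measure.prod_prod, smul_eq_mul]
  exact ENNReal.mul_lt_top ENNReal.ofReal_lt_top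
    (ENNReal.mul_lt_top hΛ.measure_lt_top (measure_lt_top _ _))

lemma restrict_intensity (z : ℝ) (R : Measure S) [SFinite R] (Λ : Set (Loc d)) :
    ENNReal.ofReal z • ((volume : Measure (Loc d)).restrict Λ).prod R =
      (intensity d z R).restrict (Λ ×ˢ univ) := by
  rw [intensity, Measure.restrict_smul, ← Measure.prod_restrict, Measure.restrict_univ]

lemma poissonIn_eq (z : ℝ) (R : Measure S) [SFinite R] (Λ : Set (Loc d)) :
    poissonIn z R Λ = poissonLaw ((intensity d z R).restrict (Λ ×ˢ univ)) := by
  rw [poissonIn, restrict_intensity]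

lemma isFiniteMeasure_restrict_intensity (z : ℝ) (R : Measure S) [IsFiniteMeasure R]
    {Λ : Set (Loc d)} (hΛ : Bornology.IsBounded Λ) :
    IsFiniteMeasure ((intensity d z R).restrict (Λ ×ˢ univ)) :=
  ⟨by rw [Measure.restrict_apply_univ]; exact intensity_lt_top z R Λ hΛ⟩

lemma isProbabilityMeasure_poissonIn (z : ℝ) (R : Measure S) [IsFiniteMeasure R]
    {Λ : Set (Loc d)} (hΛ : Bornology.IsBounded Λ) : IsProbabilityMeasure (poissonIn z R Λ) := by
  have := isFiniteMeasure_restrict_intensity z R hΛ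
  rw [poissonIn_eq]
  infer_instance

/-- The index of the block `[a, b)^d + (b - a)κ` containing `x`. -/
noncomputable def blockIndex (a b : ℝ) (x : Loc d) : Fin d → ℤ := fun i => ⌊(x i - a) / (b - a)⌋

/-- Shifting by `(b - a)κ` adds `κ` to the floor, so the index is `κ` exactly when the original
floor vanishes. The blocks are thus the fibres of `blockIndex` and partition space. -/
lemma add_mem_blockIndex {a b : ℝ} (hab : a < b) (κ : Fin d → ℤ) (x : Loc d) :
    blockIndex a b (x + (b - a) • latticeVec κ) = κ ↔ x ∈ box d a b := by
  have hpos : 0 < b - a := sub_pos.2 hab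
  simp only [funext_iff, blockIndex, box, mem_ofPred_eq]
  refine forall_congr' fun i => ?_
  have e : ((x + (b - a) • latticeVec κ : Loc d) i - a) / (b - a) = (x i - a) / (b - a) + κ i := by
    simp only [latticeVec, PiLp.add_apply, PiLp.smul_apply, smul_eq_mul]
    field_simp
    ring
  rw [e, Int.floor_add_intCast, add_eq_right, Int.floor_eq_zero_iff, mem_Ico,
    le_div_iff₀ hpos, zero_mul, div_lt_one hpos]
  constructor <;> rintro ⟨h1, h2⟩ <;> constructor <;> linarith

lemma measurable_blockIndex (a b : ℝ) : Measurable (blockIndex a b : Loc d → Fin d → ℤ) := by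
  unfold blockIndex
  refine measurable_pi_lambda _ fun i => Int.measurable_floor.comp ?_
  fun_prop

/-- The part of a function in a block, transported to the reference block. -/
noncomputable def blockPart (a b : ℝ) (f : Loc d × S → ℝ) (κ : Fin d → ℤ) : Loc d × S → ℝ :=
  (box d a b ×ˢ univ).indicator fun p => f (shift S ((b - a) • latticeVec κ) p)

lemma IsTestFunction.comp_shift {f : Loc d × S → ℝ} (hf : IsTestFunction f) (v : Loc d) :
    IsTestFunction fun p => f (shift S v p) where
  measurable := hf.measurable.comp (shift S v).measurable
  bounded := hf.bounded.imp fun C hC p => hC _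
  local_support := by
    obtain ⟨r, hr⟩ := hf.local_support
    refine ⟨r + ‖v‖, fun p hp => hr _ ?_⟩
    have := norm_sub_norm_le p.1 (-v)
    rw [sub_neg_eq_add, norm_neg] at this
    simp only [shift_apply]
    linarith

lemma IsTestFunction.blockPart {f : Loc d × S → ℝ} (hf : IsTestFunction f) (a b : ℝ)
    (κ : Fin d → ℤ) : IsTestFunction (blockPart a b f κ) where
  measurable := (hf.comp_shift _).measurable.indicator
    ((measurableSet_box d a b).prod MeasurableSet.univ)
  bounded := (hf.comp_shift _).bounded.imp fun C hC p =>
    (norm_indicator_le_norm_self _ _).trans (hC p)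
  local_support := (hf.comp_shift _).local_support.imp fun r hr p hp => by
    rw [MarkedGibbs.blockPart, indicator_apply_eq_zero]
    exact fun _ => hr p hp

/-- The finite set of blocks which can meet the ball of radius `r`. -/
noncomputable def blocksMeeting (d : ℕ) (a b r : ℝ) : Finset (Fin d → ℤ) :=
  Fintype.piFinset fun _ => Finset.Icc (-⌈(|a| + |b| + r) / (b - a)⌉) ⌈(|a| + |b| + r) / (b - a)⌉

lemma mem_blocksMeeting {a b r : ℝ} (hab : a < b) {κ : Fin d → ℤ} {x : Loc d}
    (hx : x ∈ box d a b) (hr : ‖x + (b - a) • latticeVec κ‖ ≤ r) :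
    κ ∈ blocksMeeting d a b r := by
  rw [blocksMeeting, Fintype.mem_piFinset]
  intro i
  have hn : 0 < b - a := sub_pos.2 hab
  have hi := (PiLp.norm_apply_le (x + (b - a) • latticeVec κ) i).trans hr
  have hi' : |x i + (b - a) * (κ i : ℝ)| ≤ r := by simpa [latticeVec] using hi
  have h1 := abs_le.1 hi'
  have hc := hx i
  have h0 : |(b - a) * (κ i : ℝ)| ≤ |a| + |b| + r :=
    abs_le.2 ⟨by linarith [le_abs_self b, abs_nonneg a], by linarith [neg_abs_le a, abs_nonneg b]⟩
  rw [abs_mul, abs_of_pos hn, mul_comm, ← le_div_iff₀ hn] at h0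
  have h2 := abs_le.1 (h0.trans (Int.le_ceil _))
  rw [Finset.mem_Icc]
  exact ⟨by exact_mod_cast h2.1, by exact_mod_cast h2.2⟩

lemma IsTestFunction.exists_blockPart_eq_zero {f : Loc d × S → ℝ} (hf : IsTestFunction f)
    {a b : ℝ} (hab : a < b) :
    ∃ J : Finset (Fin d → ℤ), ∀ κ ∉ J, MarkedGibbs.blockPart a b f κ = 0 := by
  obtain ⟨r, hr⟩ := hf.local_support
  refine ⟨blocksMeeting d a b r, fun κ hκ => funext fun p => ?_⟩
  rw [MarkedGibbs.blockPart, Pi.zero_apply, indicator_apply_eq_zero]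
  intro hp
  refine hr _ (not_le.1 fun h => hκ (mem_blocksMeeting hab hp.1 h))

/-- Translation invariance of the intensity carries the reference box to the fibre of index `κ`. -/
lemma setIntegral_shift {E : Type*} [NormedAddCommGroup E] [NormedSpace ℝ E] (z : ℝ)
    (R : Measure S) [SFinite R] {a b : ℝ} (hab : a < b) (κ : Fin d → ℤ) (g : Loc d × S → E) :
    ∫ p in box d a b ×ˢ univ, g (shift S ((b - a) • latticeVec κ) p) ∂(intensity d z R) =
      ∫ p in {p | blockIndex a b p.1 = κ}, g p ∂(intensity d z R) := by
  rw [← (measurePreserving_shift ((b - a) • latticeVec κ) z R).setIntegral_preimage_emb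
    (shift S _).measurableEmbedding g {p | blockIndex a b p.1 = κ}]
  congr 2
  ext p
  simp only [mem_preimage, mem_ofPred_eq, shift_apply, add_mem_blockIndex hab, mem_prod, mem_univ,
    and_true]

lemma IsTestFunction.integrable_cexp_sub_one {f : Loc d × S → ℝ} (hf : IsTestFunction f)
    {μ : Measure (Loc d × S)}
    (hμ : ∀ Λ : Set (Loc d), Bornology.IsBounded Λ → μ (Λ ×ˢ univ) < ∞) :
    Integrable (fun p => Complex.exp (f p * Complex.I) - 1) μ := by
  have := hf.measurable
  refine (hf.integrable hμ).mono (by fun_prop) (ae_of_all _ fun p => ?_)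
  have h := Real.norm_exp_I_mul_ofReal_sub_one_le (x := f p)
  rwa [mul_comm] at h

/-- The integral is countably additive over the blocks. Those outside `J` contribute nothing because
`e^{i·0} - 1 = 0`. -/
lemma sum_integral_blockPart {f : Loc d × S → ℝ} (hf : IsTestFunction f) (z : ℝ) (R : Measure S)
    [IsFiniteMeasure R] {a b : ℝ} (hab : a < b) {J : Finset (Fin d → ℤ)}
    (hJ : ∀ κ ∉ J, blockPart a b f κ = 0) :
    ∑ κ ∈ J, ∫ p, (Complex.exp (blockPart a b f κ p * Complex.I) - 1)
        ∂((intensity d z R).restrict (box d a b ×ˢ univ)) =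
      ∫ p, (Complex.exp (f p * Complex.I) - 1) ∂(intensity d z R) := by
  have hbox : MeasurableSet (box d a b ×ˢ (univ : Set S)) :=
    (measurableSet_box d a b).prod MeasurableSet.univ
  have h1 : ∀ κ, ∫ p, (Complex.exp (blockPart a b f κ p * Complex.I) - 1)
        ∂((intensity d z R).restrict (box d a b ×ˢ univ)) =
      ∫ p in {p | blockIndex a b p.1 = κ}, (Complex.exp (f p * Complex.I) - 1)
        ∂(intensity d z R) := by
    intro κ
    rw [← setIntegral_shift z R hab]
    refine setIntegral_congr_fun hbox fun p hp => ?_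
    simp only [blockPart, indicator_of_mem hp]
  have hm : ∀ κ, MeasurableSet {p : Loc d × S | blockIndex a b p.1 = κ} := fun κ =>
    ((measurable_blockIndex a b).comp measurable_fst) (measurableSet_singleton κ)
  have hd : Pairwise (Function.onFun Disjoint fun κ => {p : Loc d × S | blockIndex a b p.1 = κ}) :=
    fun κ κ' h => disjoint_left.2 fun p (hp : _ = _) (hp' : _ = _) => h (hp ▸ hp')
  have hu : ⋃ κ, {p : Loc d × S | blockIndex a b p.1 = κ} = univ :=
    eq_univ_of_forall fun p => mem_iUnion.2 ⟨_, rfl⟩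
  have h2 := integral_iUnion hm hd
    ((hf.integrable_cexp_sub_one (intensity_lt_top z R)).integrableOn)
  rw [hu, Measure.restrict_univ] at h2
  rw [h2, tsum_eq_sum (s := J)]
  · exact Finset.sum_congr rfl fun κ _ => h1 κ
  · intro κ hκ
    rw [← h1, hJ κ hκ]
    simp

/-! ### Independent blocks and stationarity of the Poisson process -/

section Glue

variable [MeasurableSingletonClass S]

lemma integral_translate (v : Loc d) (γ : Config d S) (f : Loc d × S → ℝ) :
    ∫ p, f p ∂(translate v γ).1 = ∫ p, f (shift S v p) ∂γ.1 := by
  rw [translate_val, integral_map_equiv]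

lemma charExp_translate (v : Loc d) (γ : Config d S) (f : Loc d × S → ℝ) :
    charExp f (translate v γ) = charExp (fun p => f (shift S v p)) γ := by
  rw [charExp, charExp, integral_translate]

lemma integral_glue {f : Loc d × S → ℝ} (hf : IsTestFunction f) {a b : ℝ}
    {J : Finset (Fin d → ℤ)} (hJ : ∀ κ ∉ J, blockPart a b f κ = 0)
    (γ : (Fin d → ℤ) → Config d S) :
    ∫ p, f p ∂(glue a b γ).1 = ∑ κ ∈ J, ∫ p, blockPart a b f κ p ∂(γ κ).1 := by
  have hbox : MeasurableSet (box d a b ×ˢ (univ : Set S)) :=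
    (measurableSet_box d a b).prod MeasurableSet.univ
  have h1 : ∀ κ, ∫ p, f p ∂(translate ((b - a) • latticeVec κ) (restrict (box d a b) (γ κ))).1 =
      ∫ p, blockPart a b f κ p ∂(γ κ).1 := by
    intro κ
    rw [integral_translate, blockPart, integral_indicator hbox]
    rfl
  have hint := hf.integrable (glue a b γ).2.2
  simp only [glue] at hint ⊢
  rw [integral_sum_measure hint, tsum_eq_sum (s := J)]
  · exact Finset.sum_congr rfl fun κ _ => h1 κ
  · intro κ hκ
    rw [h1, hJ κ hκ]
    simp

lemma charExp_glue {f : Loc d × S → ℝ} (hf : IsTestFunction f) {a b : ℝ}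
    {J : Finset (Fin d → ℤ)} (hJ : ∀ κ ∉ J, blockPart a b f κ = 0)
    (γ : (Fin d → ℤ) → Config d S) :
    charExp f (glue a b γ) = ∏ κ : J, charExp (blockPart a b f κ) (γ κ) := by
  rw [charExp, integral_glue hf hJ, Finset.prod_coe_sort J fun κ => charExp (blockPart a b f κ) (γ κ)]
  simp only [charExp]
  rw [← Complex.exp_sum]
  push_cast
  rw [Finset.sum_mul]

instance isProbabilityMeasure_blockField (a b : ℝ) (P : Measure (Config d S))
    [IsProbabilityMeasure P] : IsProbabilityMeasure (blockField a b P) :=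
  Measure.isProbabilityMeasure_map (measurable_glue a b).aemeasurable

/-- A test function sees finitely many blocks, so only a finite marginal of the infinite product
matters, and independence factorises the expectation. -/
lemma integral_charExp_blockField {f : Loc d × S → ℝ} (hf : IsTestFunction f) {a b : ℝ}
    {J : Finset (Fin d → ℤ)} (hJ : ∀ κ ∉ J, blockPart a b f κ = 0) (P : Measure (Config d S))
    [IsProbabilityMeasure P] :
    ∫ γ, charExp f γ ∂(blockField a b P) =
      ∏ κ ∈ J, ∫ γ, charExp (blockPart a b f κ) γ ∂P := by
  rw [blockField, integral_map (measurable_glue a b).aemeasurable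
    hf.measurable_charExp.aestronglyMeasurable]
  simp only [charExp_glue hf hJ]
  have hm : Measurable fun x : J → Config d S =>
      ∏ κ : J, charExp (blockPart a b f κ) (x κ) :=
    Finset.measurable_fun_prod _ fun κ _ =>
      (hf.blockPart a b κ).measurable_charExp.comp (measurable_pi_apply κ)
  have h := integral_restrict_infinitePi (fun _ : Fin d → ℤ => P) (s := J)
    (f := fun x => ∏ κ : J, charExp (blockPart a b f κ) (x κ)) hm.aestronglyMeasurable
  simp only [Finset.restrict] at h
  rw [h, integral_fintype_prod_eq_prod fun (κ : J) γ => charExp (blockPart a b f κ) γ,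
    Finset.prod_coe_sort J fun κ => ∫ γ, charExp (blockPart a b f κ) γ ∂P]

/-- The superposition of independent Poisson processes in the blocks is a Poisson process. -/
lemma integral_charExp_blockField_poissonIn {f : Loc d × S → ℝ} (hf : IsTestFunction f) (z : ℝ)
    (R : Measure S) [IsFiniteMeasure R] {a b : ℝ} (hab : a < b) :
    ∫ γ, charExp f γ ∂(blockField a b (poissonIn z R (box d a b))) =
      Complex.exp (∫ p, (Complex.exp (f p * Complex.I) - 1) ∂(intensity d z R)) := by
  have := isProbabilityMeasure_poissonIn z R (isBounded_box d a b)
  have := isFiniteMeasure_restrict_intensity z R (isBounded_box d a b)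
  obtain ⟨J, hJ⟩ := hf.exists_blockPart_eq_zero hab
  rw [integral_charExp_blockField hf hJ, ← sum_integral_blockPart hf z R hab hJ, Complex.exp_sum]
  refine Finset.prod_congr rfl fun κ _ => ?_
  rw [poissonIn_eq, integral_charExp_poissonLaw _ (hf.blockPart a b κ)]

/-- The Poisson process is stationary, and its parts in the blocks of any grid are independent
Poisson processes. -/
theorem poissonProcess_eq_map_translate (z : ℝ) (R : Measure S) [IsFiniteMeasure R] {a b : ℝ}
    (hab : a < b) (v : Loc d) :
    poissonProcess d z R = (blockField a b (poissonIn z R (box d a b))).map (translate v) := by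
  have h1 := isProbabilityMeasure_poissonIn z R (isBounded_box d a b)
  have h2 := isProbabilityMeasure_poissonIn z R (isBounded_box d 0 1)
  have h3 : IsProbabilityMeasure (poissonProcess d z R) := by
    rw [poissonProcess]; infer_instance
  have h4 := Measure.isProbabilityMeasure_map
    (μ := blockField a b (poissonIn z R (box d a b))) (measurable_translate v).aemeasurable
  refine ext_of_charFunctional fun f hf => ?_
  rw [poissonProcess, integral_charExp_blockField_poissonIn hf z R zero_lt_one,
    integral_map (measurable_translate v).aemeasurable
      hf.measurable_charExp.aestronglyMeasurable]
  simp only [charExp_translate]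
  -- The functional depends on `f` only through an integral against the translation-invariant
  -- intensity. Neither the grid nor the shift `v` leaves a trace.
  rw [integral_charExp_blockField_poissonIn (hf.comp_shift v) z R hab,
    (measurePreserving_shift v z R).integral_comp (shift S v).measurableEmbedding
      (fun p => Complex.exp (f p * Complex.I) - 1)]

end Glue

end Blocks

/-! ### Entropy of block fields in a window -/

section BlockEntropy

open InformationTheory

variable {d : ℕ} {S : Type*} [MeasurableSpace S] [MeasurableSingletonClass S]

lemma translate_apply (v : Loc d) (γ : Config d S) (B : Set (Loc d × S)) :
    (translate v γ).1 B = γ.1 (shift S v ⁻¹' B) := by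
  rw [translate_val, MeasurableEquiv.map_apply]

lemma restrict_apply (Λ : Set (Loc d)) (γ : Config d S) {B : Set (Loc d × S)}
    (hB : MeasurableSet B) : (restrict Λ γ).1 B = γ.1 (B ∩ Λ ×ˢ univ) :=
  Measure.restrict_apply hB

lemma glue_apply (a b : ℝ) (γ : (Fin d → ℤ) → Config d S) {B : Set (Loc d × S)}
    (hB : MeasurableSet B) :
    (glue a b γ).1 B =
      ∑' κ, (γ κ).1 (shift S ((b - a) • latticeVec κ) ⁻¹' B ∩ box d a b ×ˢ univ) := by
  simp only [glue, Measure.sum_apply _ hB]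
  refine tsum_congr fun κ => ?_
  rw [translate_apply, restrict_apply _ _ ((shift S _).measurable hB)]

lemma emptyConfig_apply (B : Set (Loc d × S)) : (emptyConfig : Config d S).1 B = 0 := by
  simp [emptyConfig, ofPoints]

/-- The parts of a family of configurations in the reference block, for finitely many indices. -/
noncomputable def blockParts (a b : ℝ) (J : Finset (Fin d → ℤ))
    (γ : (Fin d → ℤ) → Config d S) : J → Config d S :=
  fun κ => restrict (box d a b) (γ κ)

/-- Extension of a finite family of configurations by empty configurations. -/
noncomputable def fillEmpty (J : Finset (Fin d → ℤ)) (y : J → Config d S) :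
    (Fin d → ℤ) → Config d S :=
  fun κ => if h : κ ∈ J then y ⟨κ, h⟩ else emptyConfig

lemma measurable_fillEmpty (J : Finset (Fin d → ℤ)) :
    Measurable (fillEmpty J : (J → Config d S) → (Fin d → ℤ) → Config d S) := by
  refine measurable_pi_lambda _ fun κ => ?_
  by_cases h : κ ∈ J
  · simpa only [fillEmpty, h, dite_true] using measurable_pi_apply _
  · simpa only [fillEmpty, h, dite_false] using measurable_const

lemma measurable_blockParts (a b : ℝ) (J : Finset (Fin d → ℤ)) :
    Measurable (blockParts a b J : ((Fin d → ℤ) → Config d S) → J → Config d S) :=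
  measurable_pi_lambda _ fun κ =>
    (measurable_restrict (measurableSet_box d a b)).comp (measurable_pi_apply κ.1)

lemma map_blockParts (a b : ℝ) (J : Finset (Fin d → ℤ)) (P : Measure (Config d S))
    [IsProbabilityMeasure P] :
    (Measure.infinitePi fun _ : Fin d → ℤ => P).map (blockParts a b J) =
      Measure.pi fun _ : J => P.map (restrict (box d a b)) := by
  have hr := measurable_restrict (S := S) (measurableSet_box d a b)
  have := Measure.isProbabilityMeasure_map (μ := P) hr.aemeasurable
  rw [← Measure.infinitePi_map_restrict (fun _ : Fin d → ℤ => P.map (restrict (box d a b))),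
    ← Measure.infinitePi_map_pi (fun _ : Fin d → ℤ => P) (f := fun _ => restrict (box d a b))
      fun _ => hr, Measure.map_map (Finset.measurable_restrict J)]
  · rfl
  · exact measurable_pi_lambda _ fun κ => hr.comp (measurable_pi_apply κ)

lemma map_restrict_blockField {a b : ℝ} (v : Loc d) {Λ : Set (Loc d)} (hΛ : MeasurableSet Λ)
    (P : Measure (Config d S)) :
    ((blockField a b P).map (translate v)).map (restrict Λ) =
      (Measure.infinitePi fun _ : Fin d → ℤ => P).map
        fun γ => restrict Λ (translate v (glue a b γ)) := by
  rw [blockField, Measure.map_map (measurable_translate v) (measurable_glue a b),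
    Measure.map_map (measurable_restrict hΛ) ((measurable_translate v).comp (measurable_glue a b))]
  rfl

/-- Blocks outside `J` miss the window and may be emptied. The observed configuration is therefore a
function of finitely many block parts. -/
lemma restrict_translate_glue {a b : ℝ} {v : Loc d} {Λ : Set (Loc d)} (hΛ : MeasurableSet Λ)
    {J : Finset (Fin d → ℤ)}
    (hJ : ∀ x ∈ box d a b, ∀ κ, x + (b - a) • latticeVec κ + v ∈ Λ → κ ∈ J)
    (γ : (Fin d → ℤ) → Config d S) :
    restrict Λ (translate v (glue a b γ)) =
      restrict Λ (translate v (glue a b (fillEmpty J (blockParts a b J γ)))) := by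
  refine Subtype.ext (Measure.ext fun B hB => ?_)
  have hbox : MeasurableSet (box d a b ×ˢ (univ : Set S)) :=
    (measurableSet_box d a b).prod MeasurableSet.univ
  have hm := (shift S v).measurable (hB.inter (hΛ.prod MeasurableSet.univ))
  rw [restrict_apply _ _ hB, restrict_apply _ _ hB, translate_apply, translate_apply,
    glue_apply _ _ _ hm, glue_apply _ _ _ hm]
  refine tsum_congr fun κ => ?_
  by_cases h : κ ∈ J
  · simp only [fillEmpty, h, dite_true, blockParts]
    rw [restrict_apply _ _ (((shift S _).measurable hm).inter hbox), inter_assoc, inter_self]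
  · simp only [fillEmpty, h, dite_false, emptyConfig_apply]
    convert measure_empty (μ := (γ κ).1)
    rw [eq_empty_iff_forall_notMem]
    rintro p ⟨⟨_, hp⟩, hp'⟩
    exact h (hJ p.1 hp'.1 κ hp.1)

/-- Under both laws the window is the image, by one and the same map `ψ`, of `J.card` independent
blocks. Data processing and additivity over products conclude. -/
lemma relEntropy_blockField_le {a b : ℝ} {v : Loc d} {Λ : Set (Loc d)} (hΛ : MeasurableSet Λ)
    {J : Finset (Fin d → ℤ)}
    (hJ : ∀ x ∈ box d a b, ∀ κ, x + (b - a) • latticeVec κ + v ∈ Λ → κ ∈ J)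
    (P P' : Measure (Config d S)) [IsProbabilityMeasure P] [IsProbabilityMeasure P'] :
    relEntropy Λ ((blockField a b P).map (translate v)) ((blockField a b P').map (translate v)) ≤
      J.card * relEntropy (box d a b) P P' := by
  have hr := measurable_restrict (S := S) (measurableSet_box d a b)
  set ψ : (J → Config d S) → Config d S := fun y =>
    restrict Λ (translate v (glue a b (fillEmpty J y))) with hψ
  have hψm : Measurable ψ := (measurable_restrict hΛ).comp ((measurable_translate v).comp
    ((measurable_glue a b).comp (measurable_fillEmpty J)))
  have key : ∀ Q : Measure (Config d S), IsProbabilityMeasure Q →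
      ((blockField a b Q).map (translate v)).map (restrict Λ) =
        (Measure.pi fun _ : J => Q.map (restrict (box d a b))).map ψ := by
    intro Q _
    rw [map_restrict_blockField v hΛ, ← map_blockParts, Measure.map_map hψm
      (measurable_blockParts a b J)]
    congr 1
    funext γ
    exact restrict_translate_glue hΛ hJ γ
  have := Measure.isProbabilityMeasure_map (μ := P) hr.aemeasurable
  have := Measure.isProbabilityMeasure_map (μ := P') hr.aemeasurable
  rw [relEntropy, key P ‹_›, key P' ‹_›]
  refine (klDiv_map_le (μ := Measure.pi fun _ : J => P.map (restrict (box d a b)))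
    (ν := Measure.pi fun _ : J => P'.map (restrict (box d a b))) (hg := hψm)).trans_eq ?_
  rw [klDiv_pi, relEntropy, Fintype.card_coe]

/-- A block lying entirely in the window can be read off from it: undo the shift and cut to the
reference box. Disjointness of the blocks excludes points of any other index. -/
lemma restrict_translate_restrict_glue {a b : ℝ} (hab : a < b) {v : Loc d} {Λ : Set (Loc d)}
    (hΛ : MeasurableSet Λ) {κ : Fin d → ℤ}
    (hκ : ∀ x ∈ box d a b, x + (b - a) • latticeVec κ + v ∈ Λ)
    (γ : (Fin d → ℤ) → Config d S) :
    restrict (box d a b) (translate (-((b - a) • latticeVec κ + v))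
      (restrict Λ (translate v (glue a b γ)))) = restrict (box d a b) (γ κ) := by
  refine Subtype.ext (Measure.ext fun B hB => ?_)
  have hbox : MeasurableSet (box d a b ×ˢ (univ : Set S)) :=
    (measurableSet_box d a b).prod MeasurableSet.univ
  have h1 := (shift S (-((b - a) • latticeVec κ + v))).measurable (hB.inter hbox)
  have h2 := (shift S v).measurable (h1.inter (hΛ.prod MeasurableSet.univ))
  rw [restrict_apply _ _ hB, translate_apply, restrict_apply _ _ h1, translate_apply,
    glue_apply _ _ _ h2, restrict_apply _ _ hB, tsum_eq_single κ]
  · congr 1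
    ext p
    simp only [mem_inter_iff, mem_preimage, shift_apply, mem_prod, mem_univ, and_true]
    have e : p.1 + (b - a) • latticeVec κ + v + -((b - a) • latticeVec κ + v) = p.1 := by abel
    rw [e]
    constructor
    · rintro ⟨⟨⟨h, _⟩, _⟩, h'⟩
      exact ⟨h, h'⟩
    · rintro ⟨h, h'⟩
      exact ⟨⟨⟨h, h'⟩, hκ _ h'⟩, h'⟩
  · intro κ' hne
    convert measure_empty (μ := (γ κ').1)
    rw [eq_empty_iff_forall_notMem]
    rintro p ⟨⟨⟨_, hp⟩, _⟩, hp'⟩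
    have h3 := (add_mem_blockIndex hab κ' p.1).2 hp'.1
    have h4 := (add_mem_blockIndex hab κ _).2 hp.1
    simp only [shift_apply] at h4
    rw [show p.1 + (b - a) • latticeVec κ' + v + -((b - a) • latticeVec κ + v) +
      (b - a) • latticeVec κ = p.1 + (b - a) • latticeVec κ' by abel, h3] at h4
    exact hne h4

/-- Data processing in the opposite direction: `τ` extracts from the window the parts in the blocks
of `J`, which are independent. -/
lemma le_relEntropy_blockField {a b : ℝ} (hab : a < b) {v : Loc d} {Λ : Set (Loc d)}
    (hΛ : MeasurableSet Λ) {J : Finset (Fin d → ℤ)}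
    (hJ : ∀ κ ∈ J, ∀ x ∈ box d a b, x + (b - a) • latticeVec κ + v ∈ Λ)
    (P P' : Measure (Config d S)) [IsProbabilityMeasure P] [IsProbabilityMeasure P'] :
    J.card * relEntropy (box d a b) P P' ≤ relEntropy Λ ((blockField a b P).map (translate v))
      ((blockField a b P').map (translate v)) := by
  have hr := measurable_restrict (S := S) (measurableSet_box d a b)
  set τ : Config d S → J → Config d S := fun γ κ =>
    restrict (box d a b) (translate (-((b - a) • latticeVec κ.1 + v)) γ) with hτ
  have hτm : Measurable τ := measurable_pi_lambda _ fun κ => hr.comp (measurable_translate _)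
  have hgm : Measurable fun γ : (Fin d → ℤ) → Config d S =>
      restrict Λ (translate v (glue a b γ)) := (measurable_restrict hΛ).comp
    ((measurable_translate v).comp (measurable_glue a b))
  have key : ∀ Q : Measure (Config d S), IsProbabilityMeasure Q →
      (((blockField a b Q).map (translate v)).map (restrict Λ)).map τ =
        Measure.pi fun _ : J => Q.map (restrict (box d a b)) := by
    intro Q _
    rw [map_restrict_blockField v hΛ, ← map_blockParts, Measure.map_map hτm hgm]
    congr 1
    funext γ κ
    exact restrict_translate_restrict_glue hab hΛ (hJ κ.1 κ.2) γ
  have := Measure.isProbabilityMeasure_map (μ := P) hr.aemeasurable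
  have := Measure.isProbabilityMeasure_map (μ := P') hr.aemeasurable
  have h := klDiv_pi (ι := J) (P.map (restrict (box d a b))) (P'.map (restrict (box d a b)))
  rw [← key P ‹_›, ← key P' ‹_›, Fintype.card_coe] at h
  rw [relEntropy, relEntropy, ← h]
  have := Measure.isProbabilityMeasure_map (μ := blockField a b P)
    (measurable_translate v).aemeasurable
  have := Measure.isProbabilityMeasure_map (μ := blockField a b P')
    (measurable_translate v).aemeasurable
  have := Measure.isProbabilityMeasure_map (μ := (blockField a b P).map (translate v))
    (measurable_restrict hΛ).aemeasurable
  have := Measure.isProbabilityMeasure_map (μ := (blockField a b P').map (translate v))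
    (measurable_restrict hΛ).aemeasurable
  exact klDiv_map_le (μ := ((blockField a b P).map (translate v)).map (restrict Λ))
    (ν := ((blockField a b P').map (translate v)).map (restrict Λ)) (hg := hτm)

end BlockEntropy

/-! ### Counting blocks and passing to the limit -/

section SpecificEntropy

open InformationTheory

lemma volume_cube (d n : ℕ) : volume (cube d n) = (2 * n : ℝ≥0∞) ^ d := by
  have h : cube d n = (WithLp.ofLp : Loc d → Fin d → ℝ) ⁻¹'
      (Set.pi univ fun _ => Set.Ico (-(n : ℝ)) n) := by
    ext x
    simp [cube, box]
  rw [h, (PiLp.volume_preserving_ofLp (Fin d)).measure_preimage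
    (MeasurableSet.univ_pi fun _ => measurableSet_Ico).nullMeasurableSet, Real.volume_pi_Ico]
  simp only [Finset.prod_const, Finset.card_univ, Fintype.card_fin]
  congr 1
  rw [sub_neg_eq_add, ← two_mul, ENNReal.ofReal_mul zero_le_two]
  simp

/-- The lattice cube `{-k, …, k}^d`. -/
noncomputable def latticeCube (d k : ℕ) : Finset (Fin d → ℤ) :=
  Fintype.piFinset fun _ => Finset.Icc (-(k : ℤ)) k

lemma card_latticeCube (d k : ℕ) : (latticeCube d k).card = (2 * k + 1) ^ d := by
  simp only [latticeCube, Fintype.card_piFinset_const, Int.card_Icc]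
  congr 1
  omega

/-- The lattice points in the cube `[-n, n)^d`. -/
noncomputable def latticePoints (d n : ℕ) : Finset (Fin d → ℤ) :=
  Fintype.piFinset fun _ => Finset.Ico (-(n : ℤ)) n

lemma card_latticePoints (d n : ℕ) : (latticePoints d n).card = (2 * n) ^ d := by
  simp only [latticePoints, Fintype.card_piFinset_const, Int.card_Ico]
  congr 1
  omega

lemma latticePoints_bounds {d n : ℕ} {κ : Fin d → ℤ} (hκ : κ ∈ latticePoints d n) (i : Fin d) :
    -(n : ℝ) ≤ κ i ∧ (κ i : ℝ) < n := by
  have h := Finset.mem_Ico.1 (Fintype.mem_piFinset.1 hκ i)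
  exact ⟨by exact_mod_cast h.1, by exact_mod_cast h.2⟩

lemma block_coordinate {d n : ℕ} (x : Loc d) (κ v : Fin d → ℤ) (i : Fin d) :
    (x + ((n : ℝ) - -(n : ℝ)) • latticeVec κ + latticeVec v : Loc d) i =
      x i + 2 * n * κ i + v i := by
  simp only [latticeVec, PiLp.add_apply, PiLp.smul_apply, smul_eq_mul]
  ring

/-- Point and shift each have coordinates in `[-n, n)`, so `|2n κ_i| < N + 2n ≤ 2n(k + 1)`. The
strict inequality gives `|κ_i| ≤ k`. -/
lemma mem_latticeCube_of_block_meets {d n N k : ℕ} (hn : 1 ≤ n) (hN : N ≤ 2 * n * k)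
    {v : Fin d → ℤ} (hv : v ∈ latticePoints d n) {x : Loc d} (hx : x ∈ box d (-(n : ℝ)) n)
    {κ : Fin d → ℤ}
    (hκ : x + ((n : ℝ) - -(n : ℝ)) • latticeVec κ + latticeVec v ∈ cube d N) :
    κ ∈ latticeCube d k := by
  refine Fintype.mem_piFinset.2 fun i => Finset.mem_Icc.2 ?_
  have h := hκ i
  rw [block_coordinate] at h
  have hvi := latticePoints_bounds hv i
  have hxi := hx i
  have hn' : (1 : ℝ) ≤ n := by exact_mod_cast hn
  have hN' : (N : ℝ) ≤ 2 * n * k := by exact_mod_cast hN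
  have h1 : (2 * n : ℝ) * κ i < 2 * n * (k + 1) := by linarith
  have h2 : (2 * n : ℝ) * (-(k + 1)) < 2 * n * κ i := by linarith
  have h1' : (κ i : ℝ) < k + 1 := lt_of_mul_lt_mul_left h1 (by positivity)
  have h2' : (-(k + 1) : ℝ) < κ i := lt_of_mul_lt_mul_left h2 (by positivity)
  have h3 : κ i < k + 1 := by exact_mod_cast h1'
  have h4 : -((k : ℤ) + 1) < κ i := by exact_mod_cast h2'
  omega

lemma block_subset_cube {d n N k : ℕ} (hN : 2 * n * (k + 1) ≤ N)
    {v : Fin d → ℤ} (hv : v ∈ latticePoints d n) {x : Loc d} (hx : x ∈ box d (-(n : ℝ)) n)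
    {κ : Fin d → ℤ} (hκ : κ ∈ latticeCube d k) :
    x + ((n : ℝ) - -(n : ℝ)) • latticeVec κ + latticeVec v ∈ cube d N := by
  intro i
  rw [block_coordinate]
  have hκi := Finset.mem_Icc.1 (Fintype.mem_piFinset.1 hκ i)
  have hvi := latticePoints_bounds hv i
  have hxi := hx i
  have hN' : (2 * n * (k + 1) : ℝ) ≤ N := by exact_mod_cast hN
  have h1 : (κ i : ℝ) ≤ k := by exact_mod_cast hκi.2
  have h2 : -(k : ℝ) ≤ κ i := by exact_mod_cast hκi.1
  have h3 : (2 * n : ℝ) * κ i ≤ 2 * n * k := mul_le_mul_of_nonneg_left h1 (by positivity)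
  have h4 : (2 * n : ℝ) * -k ≤ 2 * n * κ i := mul_le_mul_of_nonneg_left h2 (by positivity)
  constructor <;> linarith

lemma tendsto_natDiv_div (m : ℕ) :
    Tendsto (fun N : ℕ => ((N / m : ℕ) : ℝ) / N) atTop (𝓝 (m : ℝ)⁻¹) := by
  have h := (tendsto_nat_floor_mul_div_atTop (R := ℝ) (a := (m : ℝ)⁻¹) (by positivity)).comp
    tendsto_natCast_atTop_atTop
  refine h.congr fun N => ?_
  simp only [Function.comp]
  rw [inv_mul_eq_div, Nat.floor_div_eq_div]

/-- The additive constant `c` covers both block counts, which differ only by boundary terms. -/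
lemma tendsto_block_count_div (m : ℕ) (d : ℕ) (c I : ℝ) :
    Tendsto (fun N : ℕ => (2 * ((N / m : ℕ) : ℝ) + c) ^ d * I / (2 * N : ℝ) ^ d) atTop
      (𝓝 (I / (m : ℝ) ^ d)) := by
  have h1 : Tendsto (fun N : ℕ => ((N / m : ℕ) : ℝ) / N + c / 2 * (N : ℝ)⁻¹) atTop
      (𝓝 ((m : ℝ)⁻¹ + c / 2 * 0)) :=
    (tendsto_natDiv_div m).add (tendsto_natCast_atTop_atTop.inv_tendsto_atTop.const_mul _)
  have h2 := (h1.pow d).mul_const I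
  rw [mul_zero, add_zero, inv_pow, inv_mul_eq_div] at h2
  refine h2.congr' ?_
  filter_upwards [eventually_gt_atTop 0] with N hN
  have hN' : (N : ℝ) ≠ 0 := by positivity
  rw [mul_div_right_comm, ← div_pow]
  congr 2
  field_simp

variable {d : ℕ} {S : Type*} [MeasurableSpace S] [MeasurableSingletonClass S]

/-- The average over lattice shifts of independent repetitions in blocks of side `2n` has a
specific entropy, namely the relative entropy in a block divided by its volume. -/
theorem hasSpecificEntropy_average (hd : 1 ≤ d) {n : ℕ} (hn : 1 ≤ n) (z : ℝ) (R : Measure S)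
    [IsProbabilityMeasure R] (P : Measure (Config d S)) [IsProbabilityMeasure P]
    (hI : relEntropy (cube d n) P (poissonIn z R (cube d n)) ≠ ∞) :
    HasSpecificEntropy
      (((2 * n : ℝ≥0∞) ^ d)⁻¹ • ∑ κ ∈ latticePoints d n,
        (blockField (-n) n P).map (translate (latticeVec κ)))
      (poissonProcess d z R)
      (relEntropy (cube d n) P (poissonIn z R (cube d n)) / (2 * n : ℝ≥0∞) ^ d) := by
  have := isProbabilityMeasure_poissonIn z R (isBounded_cube d n)
  have hn' : (1 : ℝ) ≤ n := by exact_mod_cast hn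
  have hab : -(n : ℝ) < n := by linarith
  set I := relEntropy (cube d n) P (poissonIn z R (cube d n)) with hIdef
  set s := latticePoints d n with hs
  set π := poissonProcess d z R with hπ
  -- One reference measure is written with the grid of each shift in turn, so that all shifted
  -- fields are compared with the same `π`.
  have hπκ : ∀ v : Loc d, π =
      (blockField (-(n : ℝ)) n (poissonIn z R (cube d n))).map (translate v) := fun v =>
    poissonProcess_eq_map_translate z R hab v
  have hne : s.Nonempty := by
    rw [← Finset.card_pos, card_latticePoints]
    positivity
  have : Nonempty s := hne.to_subtype
  set Q : ℕ → s → Measure (Config d S) := fun N κ =>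
    ((blockField (-(n : ℝ)) n P).map (translate (latticeVec κ.1))).map (restrict (cube d N)) with hQ
  have hr : ∀ N, Measurable (restrict (cube d N) : Config d S → Config d S) := fun N =>
    measurable_restrict (measurableSet_box d _ _)
  have hQp : ∀ N κ, IsProbabilityMeasure (Q N κ) := fun N κ => by
    have := Measure.isProbabilityMeasure_map (μ := blockField (-(n : ℝ)) n P)
      (measurable_translate (latticeVec κ.1)).aemeasurable
    exact Measure.isProbabilityMeasure_map (hr N).aemeasurable
  have hπp : IsProbabilityMeasure π := by
    have := isProbabilityMeasure_poissonIn z R (isBounded_box d 0 1)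
    rw [hπ, poissonProcess]
    infer_instance
  have hπN : ∀ N, IsProbabilityMeasure (π.map (restrict (cube d N))) := fun N =>
    Measure.isProbabilityMeasure_map (hr N).aemeasurable
  have hupper : ∀ N κ, klDiv (Q N κ) (π.map (restrict (cube d N))) ≤
      ((2 * (N / (2 * n)) + 3 : ℕ) ^ d : ℕ) * I := by
    intro N κ
    -- Rounding up to `k = N / (2n) + 1` covers the window; the lattice cube then has side `2k + 1 =
    -- 2(N / (2n)) + 3`.
    have hN : N ≤ 2 * n * (N / (2 * n) + 1) := (Nat.lt_mul_div_succ N (by positivity)).le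
    have h := relEntropy_blockField_le (measurableSet_box d (-(N : ℝ)) N)
      (J := latticeCube d (N / (2 * n) + 1))
      (fun x hx κ' hκ' => mem_latticeCube_of_block_meets hn hN κ.2 hx hκ') P
      (poissonIn z R (cube d n))
    rw [card_latticeCube] at h
    rw [hπκ (latticeVec κ.1)]
    exact h
  have hlower : ∀ N κ, 2 * n ≤ N → ((2 * (N / (2 * n)) - 1 : ℕ) ^ d : ℕ) * I ≤
      klDiv (Q N κ) (π.map (restrict (cube d N))) := by
    intro N κ hN2
    have h1 : 1 ≤ N / (2 * n) := (Nat.one_le_div_iff (by positivity)).2 hN2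
    -- One layer is given up to absorb the shift and the block width. The assumption `2n ≤ N` keeps
    -- the natural subtraction genuine.
    have hN : 2 * n * (N / (2 * n) - 1 + 1) ≤ N := by
      rw [Nat.sub_add_cancel h1]
      exact Nat.mul_div_le N (2 * n)
    have h := le_relEntropy_blockField hab (measurableSet_box d (-(N : ℝ)) N)
      (J := latticeCube d (N / (2 * n) - 1))
      (fun κ' hκ' x hx => block_subset_cube hN κ.2 hx hκ') P (poissonIn z R (cube d n))
    rw [card_latticeCube, show 2 * (N / (2 * n) - 1) + 1 = 2 * (N / (2 * n)) - 1 by omega] at h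
    rw [hπκ (latticeVec κ.1)]
    exact h
  -- Finite divergence forces absolute continuity, which the two mixture inequalities require.
  have hac : ∀ N κ, Q N κ ≪ π.map (restrict (cube d N)) := by
    intro N κ
    refine (klDiv_ne_top_iff.1 (ne_top_of_le_ne_top ?_ (hupper N κ))).1
    exact ENNReal.mul_ne_top (ENNReal.natCast_ne_top _) hI
  have hc : ((Finset.univ : Finset s).card : ℝ≥0∞) = (2 * n : ℝ≥0∞) ^ d := by
    rw [Finset.card_univ, Fintype.card_coe, hs, card_latticePoints]
    push_cast
    rfl
  set a : ℕ → ℝ≥0∞ := fun N => klDiv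
    (((Finset.univ : Finset s).card : ℝ≥0∞)⁻¹ • ∑ κ, Q N κ) (π.map (restrict (cube d N))) with ha
  have hrel : ∀ N, relEntropy (cube d N) (((2 * n : ℝ≥0∞) ^ d)⁻¹ • ∑ κ ∈ s,
      (blockField (-n) n P).map (translate (latticeVec κ))) π = a N := by
    intro N
    rw [relEntropy, Measure.map_smul, ha, hc]
    congr 2
    rw [← Measure.mapₗ_apply_of_measurable (hr N), map_sum, ← Finset.sum_coe_sort s]
    simp only [Measure.mapₗ_apply_of_measurable (hr N), hQ]
  have hconst : ∀ b : ℝ≥0∞, ((Finset.univ : Finset s).card : ℝ≥0∞)⁻¹ * ∑ _κ : s, b = b := by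
    intro b
    rw [Finset.sum_const, nsmul_eq_mul, ← mul_assoc, ENNReal.inv_mul_cancel _ (by simp), one_mul]
    simpa using hne.ne_empty
  have haU : ∀ N, a N ≤ ((2 * (N / (2 * n)) + 3 : ℕ) ^ d : ℕ) * I := fun N =>
    (klDiv_average_le Finset.univ_nonempty (hac N)).trans <| by
      rw [← hconst (((2 * (N / (2 * n)) + 3 : ℕ) ^ d : ℕ) * I)]
      gcongr with κ
      exact hupper N κ
  set l : ℝ := Real.log (Finset.univ : Finset s).card with hl
  have hl0 : 0 ≤ l := Real.log_natCast_nonneg _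
  have haL : ∀ N, 2 * n ≤ N →
      ((2 * (N / (2 * n)) - 1 : ℕ) ^ d : ℕ) * I ≤ a N + ENNReal.ofReal l := fun N hN =>
    le_trans (by
      rw [← hconst (((2 * (N / (2 * n)) - 1 : ℕ) ^ d : ℕ) * I)]
      gcongr with κ
      exact hlower N κ hN) (average_klDiv_le Finset.univ_nonempty (hac N))
  have haT : ∀ N, a N ≠ ∞ := fun N =>
    ne_top_of_le_ne_top (ENNReal.mul_ne_top (ENNReal.natCast_ne_top _) hI) (haU N)
  have haUr : ∀ N, (a N).toReal ≤ (2 * ((N / (2 * n) : ℕ) : ℝ) + 3) ^ d * I.toReal := by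
    intro N
    have h := ENNReal.toReal_mono (ENNReal.mul_ne_top (ENNReal.natCast_ne_top _) hI) (haU N)
    rw [ENNReal.toReal_mul, ENNReal.toReal_natCast] at h
    push_cast at h
    exact h
  have haLr : ∀ N, 2 * n ≤ N →
      (2 * ((N / (2 * n) : ℕ) : ℝ) + -1) ^ d * I.toReal - l ≤ (a N).toReal := by
    intro N hN
    have h1 : 1 ≤ N / (2 * n) := (Nat.one_le_div_iff (by positivity)).2 hN
    have h := ENNReal.toReal_mono (ENNReal.add_ne_top.2 ⟨haT N, ENNReal.ofReal_ne_top⟩) (haL N hN)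
    rw [ENNReal.toReal_mul, ENNReal.toReal_natCast, ENNReal.toReal_add (haT N)
      ENNReal.ofReal_ne_top, ENNReal.toReal_ofReal hl0, Nat.cast_pow,
      Nat.cast_sub (by omega)] at h
    push_cast at h
    rw [← sub_eq_add_neg]
    linarith
  have hlim : Tendsto (fun N : ℕ => (a N).toReal / (2 * N : ℝ) ^ d) atTop
      (𝓝 (I.toReal / ((2 * n : ℕ) : ℝ) ^ d)) := by
    -- The mixing error is constant in `N`, and `(2N)^d` diverges because `d ≥ 1`.
    have hl' : Tendsto (fun N : ℕ => l / (2 * N : ℝ) ^ d) atTop (𝓝 0) := by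
      refine Tendsto.const_div_atTop ?_ l
      exact (tendsto_pow_atTop (by omega)).comp
        (tendsto_natCast_atTop_atTop.const_mul_atTop zero_lt_two)
    have hlow := (tendsto_block_count_div (2 * n) d (-1) I.toReal).sub hl'
    rw [sub_zero] at hlow
    refine tendsto_of_tendsto_of_tendsto_of_le_of_le' hlow
      (tendsto_block_count_div (2 * n) d 3 I.toReal) ?_ (Eventually.of_forall fun N => ?_)
    · filter_upwards [eventually_ge_atTop (2 * n)] with N hN
      rw [← sub_div]
      exact div_le_div_of_nonneg_right (haLr N hN) (by positivity)
    · exact div_le_div_of_nonneg_right (haUr N) (by positivity)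
  have hfin := ENNReal.tendsto_ofReal hlim
  rw [HasSpecificEntropy]
  have hlimit : ENNReal.ofReal (I.toReal / ((2 * n : ℕ) : ℝ) ^ d) = I / (2 * n : ℝ≥0∞) ^ d := by
    rw [ENNReal.ofReal_div_of_pos (by positivity), ENNReal.ofReal_toReal hI,
      ENNReal.ofReal_pow (by positivity), ENNReal.ofReal_natCast]
    push_cast
    rfl
  rw [hlimit] at hfin
  refine hfin.congr' ?_
  filter_upwards [eventually_gt_atTop 0] with N hN
  rw [hrel, volume_cube, ENNReal.ofReal_div_of_pos (by positivity), ENNReal.ofReal_toReal (haT N),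
    ENNReal.ofReal_pow (by positivity), ENNReal.ofReal_mul zero_le_two]
  simp

end SpecificEntropy

/-! ### Entropy of the finite-volume Gibbs measure -/

section Gibbs

open InformationTheory

variable {d : ℕ} {S : Type*} [NormedAddCommGroup S] [MeasurableSpace S] [BorelSpace S]

lemma exp_coe_ofReal {x : ℝ} (hx : 0 ≤ x) :
    EReal.exp ((ENNReal.ofReal x : ℝ≥0∞) : EReal) = ENNReal.ofReal (Real.exp x) := by
  rw [EReal.coe_ennreal_ofReal, max_eq_left hx, EReal.exp_coe]

/-- The mark weight `c(1 + ‖m‖^{d+δ})` has a finite exponential moment. -/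
lemma lintegral_exp_mark_lt_top {δ : ℝ} (hδ : 0 < δ) {R : Measure S} (hR : MarkMoment d δ R)
    {c : ℝ} (hc : 0 ≤ c) :
    ∫⁻ m, ENNReal.ofReal (Real.exp (c * (1 + ‖m‖ ^ ((d : ℝ) + δ)))) ∂(R) < ∞ := by
  have hm : Measurable fun ℓ : ℝ => ENNReal.ofReal (Real.exp (ℓ ^ ((d : ℝ) + 2 * δ))) := by
    fun_prop
  rw [MarkMoment, lintegral_map hm measurable_norm] at hR
  -- Beyond `T` one has `c ≤ ℓ^δ`, hence `c ℓ^{d+δ} ≤ ℓ^{d+2δ}`. Below `T` the constant `K`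
  -- suffices.
  set T : ℝ := c ^ δ⁻¹ with hT
  set K : ℝ := c + c * T ^ ((d : ℝ) + δ) with hK
  have hT0 : 0 ≤ T := Real.rpow_nonneg hc _
  have hbound : ∀ ℓ : ℝ, 0 ≤ ℓ →
      c * (1 + ℓ ^ ((d : ℝ) + δ)) ≤ K + ℓ ^ ((d : ℝ) + 2 * δ) := by
    intro ℓ hℓ
    have h1 : 0 ≤ ℓ ^ ((d : ℝ) + 2 * δ) := Real.rpow_nonneg hℓ _
    have h2 : 0 ≤ c * T ^ ((d : ℝ) + δ) := mul_nonneg hc (Real.rpow_nonneg hT0 _)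
    have hpos : (0 : ℝ) ≤ d + δ := by positivity
    rcases le_total ℓ T with h | h
    · have := mul_le_mul_of_nonneg_left (Real.rpow_le_rpow hℓ h hpos) hc
      rw [hK]
      linarith
    · have h3 : c ≤ ℓ ^ δ := by
        calc c = T ^ δ := by rw [hT, Real.rpow_inv_rpow hc hδ.ne']
          _ ≤ ℓ ^ δ := Real.rpow_le_rpow hT0 h hδ.le
      have h4 : ℓ ^ ((d : ℝ) + 2 * δ) = ℓ ^ δ * ℓ ^ ((d : ℝ) + δ) := by
        rw [← Real.rpow_add_of_nonneg hℓ hδ.le hpos]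
        ring_nf
      have := mul_le_mul_of_nonneg_right h3 (Real.rpow_nonneg hℓ ((d : ℝ) + δ))
      rw [h4, hK]
      linarith
  calc ∫⁻ m, ENNReal.ofReal (Real.exp (c * (1 + ‖m‖ ^ ((d : ℝ) + δ)))) ∂(R)
      ≤ ∫⁻ m, ENNReal.ofReal (Real.exp K) *
          ENNReal.ofReal (Real.exp (‖m‖ ^ ((d : ℝ) + 2 * δ))) ∂(R) := by
        refine lintegral_mono fun m => ?_
        rw [← ENNReal.ofReal_mul (Real.exp_nonneg _), ← Real.exp_add]
        exact ENNReal.ofReal_le_ofReal (Real.exp_le_exp.2 (hbound _ (norm_nonneg m)))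
    _ < ∞ := by
        rw [lintegral_const_mul _ (by fun_prop)]
        exact ENNReal.mul_lt_top ENNReal.ofReal_lt_top hR

/-- The unnormalised Gibbs density `e^{-H(γ_Λ)}`. -/
noncomputable def boltzmann (H : FinConfig d S → EReal) (Λ : Set (Loc d))
    (hΛ : Bornology.IsBounded Λ) (γ : Config d S) : ℝ≥0∞ :=
  EReal.exp (-H (restrictFin Λ hΛ γ))

lemma measurable_boltzmann {H : FinConfig d S → EReal} (hH : IsEnergy H) {Λ : Set (Loc d)}
    (hm : MeasurableSet Λ) (hΛ : Bornology.IsBounded Λ) : Measurable (boltzmann H Λ hΛ) := by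
  have h : Measurable (restrictFin Λ hΛ : Config d S → FinConfig d S) :=
    (measurable_restrict hm).subtype_mk
  exact EReal.measurable_exp.comp (hH.measurable.comp h).neg

/-- The energy bound on the density, at a single configuration. -/
lemma boltzmann_le {H : FinConfig d S → EReal} {δ c : ℝ} (hc : 0 ≤ c)
    (hst : ∀ γ : FinConfig d S,
      ((-(c * ∫ p, (1 + ‖p.2‖ ^ ((d : ℝ) + δ)) ∂γ.1.1) : ℝ) : EReal) ≤ H γ)
    (Λ : Set (Loc d)) (hΛ : Bornology.IsBounded Λ) (γ : Config d S) :
    boltzmann H Λ hΛ γ ≤ EReal.exp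
      ((∫⁻ p, ENNReal.ofReal (c * (1 + ‖p.2‖ ^ ((d : ℝ) + δ))) ∂γ.1 : ℝ≥0∞) : EReal) := by
  have hm : Measurable fun p : Loc d × S => c * (1 + ‖p.2‖ ^ ((d : ℝ) + δ)) := by fun_prop
  refine EReal.exp_monotone ?_
  have h := hst (restrictFin Λ hΛ γ)
  rw [EReal.coe_neg, EReal.neg_le] at h
  refine h.trans ?_
  rw [← integral_const_mul, integral_eq_lintegral_of_nonneg_ae
    (ae_of_all _ fun p => by positivity) hm.aestronglyMeasurable]
  set u := ∫⁻ p, ENNReal.ofReal (c * (1 + ‖p.2‖ ^ ((d : ℝ) + δ))) ∂(restrictFin Λ hΛ γ).1.1 with hu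
  -- Only this direction is needed, so finiteness of `u` plays no role.
  have h1 : ((u.toReal : ℝ) : EReal) ≤ (u : EReal) := by
    rw [← EReal.toReal_coe_ennreal]
    exact EReal.coe_toReal_le (EReal.coe_ennreal_ne_bot u)
  refine h1.trans (EReal.coe_ennreal_le_coe_ennreal_iff.2 ?_)
  exact lintegral_mono' Measure.restrict_le_self le_rfl

variable (R : Measure S) [IsProbabilityMeasure R] (z : ℝ)

lemma intensity_restrict_univ (Λ : Set (Loc d)) :
    (intensity d z R).restrict (Λ ×ˢ univ) univ = ENNReal.ofReal z * volume Λ := by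
  rw [Measure.restrict_apply_univ, intensity, Measure.smul_apply, Measure.prod_prod, smul_eq_mul,
    measure_univ, mul_one]

/-- The second moment of the Gibbs density with respect to the Poisson process. -/
lemma lintegral_boltzmann_sq_le {H : FinConfig d S → EReal} {δ c : ℝ} (hz : 0 ≤ z)
    (hδ : 0 < δ) (hR : MarkMoment d δ R) (hc : 0 ≤ c)
    (hst : ∀ γ : FinConfig d S,
      ((-(c * ∫ p, (1 + ‖p.2‖ ^ ((d : ℝ) + δ)) ∂γ.1.1) : ℝ) : EReal) ≤ H γ)
    {Λ : Set (Loc d)} (hΛ : Bornology.IsBounded Λ) :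
    ∫⁻ γ, boltzmann H Λ hΛ γ ^ 2 ∂(poissonIn z R Λ) ≤
      ENNReal.ofReal (Real.exp (z * (volume Λ).toReal *
        (∫⁻ m, ENNReal.ofReal (Real.exp (2 * c * (1 + ‖m‖ ^ ((d : ℝ) + δ)))) ∂(R)).toReal -
          z * (volume Λ).toReal)) := by
  have := isFiniteMeasure_restrict_intensity z R hΛ
  have hM := lintegral_exp_mark_lt_top hδ hR (c := 2 * c) (by positivity)
  set M := ∫⁻ m, ENNReal.ofReal (Real.exp (2 * c * (1 + ‖m‖ ^ ((d : ℝ) + δ)))) ∂(R) with hMdef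
  set f : Loc d × S → ℝ≥0∞ := fun p => ENNReal.ofReal (c * (1 + ‖p.2‖ ^ ((d : ℝ) + δ))) with hf
  have hfm : Measurable f := by fun_prop
  -- Squaring the density doubles the weight, whence the `2 * c`. The weight ignores locations, so
  -- the integral factorises as `z |Λ| M`.
  have hexp : ∫⁻ p, EReal.exp ((f p + f p : ℝ≥0∞) : EReal)
      ∂((intensity d z R).restrict (Λ ×ˢ univ)) = ENNReal.ofReal z * volume Λ * M := by
    have h1 : ∀ p, EReal.exp ((f p + f p : ℝ≥0∞) : EReal) =
        ENNReal.ofReal (Real.exp (2 * c * (1 + ‖p.2‖ ^ ((d : ℝ) + δ)))) := by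
      intro p
      rw [hf, ← ENNReal.ofReal_add (by positivity) (by positivity), exp_coe_ofReal (by positivity)]
      ring_nf
    simp only [h1]
    have hm : Measurable fun p : Loc d × S =>
        ENNReal.ofReal (Real.exp (2 * c * (1 + ‖p.2‖ ^ ((d : ℝ) + δ)))) := by fun_prop
    rw [← restrict_intensity, lintegral_smul_measure, lintegral_prod _ hm.aemeasurable]
    simp only [lintegral_const, Measure.restrict_apply_univ, smul_eq_mul]
    rw [hMdef]
    ring
  have hfin : ENNReal.ofReal z * volume Λ * M ≠ ∞ :=
    ENNReal.mul_ne_top (ENNReal.mul_ne_top ENNReal.ofReal_ne_top hΛ.measure_lt_top.ne) hM.ne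
  have h2 := lintegral_exp_poissonLaw ((intensity d z R).restrict (Λ ×ˢ univ)) (hfm.add hfm)
    (by simpa only [Pi.add_apply, hexp] using hfin)
  simp only [Pi.add_apply] at h2
  rw [hexp, intensity_restrict_univ, ← poissonIn_eq] at h2
  calc ∫⁻ γ, boltzmann H Λ hΛ γ ^ 2 ∂(poissonIn z R Λ)
      ≤ ∫⁻ γ, EReal.exp ((∫⁻ p, (f p + f p) ∂γ.1 : ℝ≥0∞) : EReal) ∂(poissonIn z R Λ) := by
        refine lintegral_mono fun γ => ?_
        rw [lintegral_add_left hfm, EReal.coe_ennreal_add, EReal.exp_add, sq]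
        exact mul_le_mul' (boltzmann_le hc hst Λ hΛ γ) (boltzmann_le hc hst Λ hΛ γ)
    _ = _ := by
        rw [h2]
        simp only [ENNReal.toReal_mul, ENNReal.toReal_ofReal hz]

/-- The empty configuration contributes `e^{-z|Λ|}` to the partition function. -/
lemma le_partitionFunction {H : FinConfig d S → EReal} (hH : IsEnergy H) (hz : 0 ≤ z)
    {Λ : Set (Loc d)} (hm : MeasurableSet Λ) (hΛ : Bornology.IsBounded Λ) :
    ENNReal.ofReal (Real.exp (-(z * (volume Λ).toReal))) ≤ partitionFunction H z R Λ hΛ := by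
  have h0 : ∀ x : Fin 0 → Loc d × S, boltzmann H Λ hΛ (ofPoints x) = 1 := by
    intro x
    have e : restrictFin Λ hΛ (ofPoints x) = ⟨emptyConfig, emptyConfig_univ⟩ := by
      refine Subtype.ext (Subtype.ext ?_)
      simp [restrictFin, restrict, ofPoints, emptyConfig]
    rw [boltzmann, e, hH.empty_eq]
    simp
  have h := lintegral_poissonLaw ((intensity d z R).restrict (Λ ×ˢ univ))
    (measurable_boltzmann hH hm hΛ)
  rw [← poissonIn_eq, intensity_restrict_univ] at h
  have h1 : partitionFunction H z R Λ hΛ = ∫⁻ γ, boltzmann H Λ hΛ γ ∂(poissonIn z R Λ) := rfl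
  rw [h1, h]
  -- Only the term with no points is kept; there the energy vanishes.
  refine le_trans ?_ (ENNReal.le_tsum 0)
  simp [h0, ENNReal.toReal_mul, ENNReal.toReal_ofReal hz]

lemma gibbs_eq_withDensity {H : FinConfig d S → EReal} (hH : IsEnergy H)
    {Λ : Set (Loc d)} (hm : MeasurableSet Λ) (hΛ : Bornology.IsBounded Λ) :
    gibbs H z R Λ hΛ = (poissonIn z R Λ).withDensity fun γ =>
      (partitionFunction H z R Λ hΛ)⁻¹ * boltzmann H Λ hΛ γ :=
  (withDensity_smul _ (measurable_boltzmann hH hm hΛ)).symm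

/-- The bound `t ≤ 1 + t²` reduces this to the second moment. -/
lemma partitionFunction_ne_top {H : FinConfig d S → EReal} (hz : 0 ≤ z) {δ : ℝ}
    (hδ : 0 < δ) (hR : MarkMoment d δ R) (hst : IsStable δ H) {Λ : Set (Loc d)}
    (hΛ : Bornology.IsBounded Λ) : partitionFunction H z R Λ hΛ ≠ ∞ := by
  obtain ⟨c, hc, hst⟩ := hst
  have := isProbabilityMeasure_poissonIn z R hΛ
  have h2 := lintegral_boltzmann_sq_le R z hz hδ hR hc hst hΛ
  have hle : partitionFunction H z R Λ hΛ ≤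
      ∫⁻ γ, (1 + boltzmann H Λ hΛ γ ^ 2) ∂(poissonIn z R Λ) := by
    refine lintegral_mono fun γ => ?_
    change boltzmann H Λ hΛ γ ≤ 1 + boltzmann H Λ hΛ γ ^ 2
    rcases le_total (boltzmann H Λ hΛ γ) 1 with h | h
    · exact h.trans le_self_add
    · exact (le_self_pow h two_ne_zero).trans le_add_self
  refine ne_top_of_le_ne_top ?_ hle
  rw [lintegral_add_left measurable_const]
  simp only [lintegral_const, measure_univ, mul_one]
  exact ENNReal.add_ne_top.2 ⟨ENNReal.one_ne_top, ne_top_of_le_ne_top ENNReal.ofReal_ne_top h2⟩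

lemma partitionFunction_ne_zero {H : FinConfig d S → EReal} (hH : IsEnergy H) (hz : 0 ≤ z)
    {Λ : Set (Loc d)} (hm : MeasurableSet Λ) (hΛ : Bornology.IsBounded Λ) :
    partitionFunction H z R Λ hΛ ≠ 0 := by
  have h := le_partitionFunction R z hH hz hm hΛ
  exact (lt_of_lt_of_le (ENNReal.ofReal_pos.2 (Real.exp_pos _)) h).ne'

lemma lintegral_normalized_boltzmann {H : FinConfig d S → EReal} (hH : IsEnergy H) (hz : 0 ≤ z)
    {δ : ℝ} (hδ : 0 < δ) (hR : MarkMoment d δ R) (hst : IsStable δ H) {Λ : Set (Loc d)}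
    (hm : MeasurableSet Λ) (hΛ : Bornology.IsBounded Λ) :
    ∫⁻ γ, (partitionFunction H z R Λ hΛ)⁻¹ * boltzmann H Λ hΛ γ ∂(poissonIn z R Λ) = 1 := by
  rw [lintegral_const_mul _ (measurable_boltzmann hH hm hΛ)]
  exact ENNReal.inv_mul_cancel (partitionFunction_ne_zero R z hH hz hm hΛ)
    (partitionFunction_ne_top R z hz hδ hR hst hΛ)

lemma isProbabilityMeasure_gibbs {H : FinConfig d S → EReal} (hH : IsEnergy H) (hz : 0 ≤ z)
    {δ : ℝ} (hδ : 0 < δ) (hR : MarkMoment d δ R) (hst : IsStable δ H) {Λ : Set (Loc d)}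
    (hm : MeasurableSet Λ) (hΛ : Bornology.IsBounded Λ) :
    IsProbabilityMeasure (gibbs H z R Λ hΛ) := by
  rw [gibbs_eq_withDensity R z hH hm hΛ]
  refine ⟨?_⟩
  rw [withDensity_apply _ MeasurableSet.univ, Measure.restrict_univ]
  exact lintegral_normalized_boltzmann R z hH hz hδ hR hst hm hΛ

/-- The relative entropy of the finite-volume Gibbs measure is of the order of the volume. -/
lemma klDiv_gibbs_le {H : FinConfig d S → EReal} (hH : IsEnergy H) (hz : 0 ≤ z)
    {δ : ℝ} (hδ : 0 < δ) (hR : MarkMoment d δ R) (hst : IsStable δ H) :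
    ∃ M : ℝ, 0 ≤ M ∧ ∀ (Λ : Set (Loc d)) (_ : MeasurableSet Λ) (hΛ : Bornology.IsBounded Λ),
      klDiv (gibbs H z R Λ hΛ) (poissonIn z R Λ) ≤
        ENNReal.ofReal (2 + z * (1 + M) * (volume Λ).toReal) := by
  obtain ⟨c, hc, hst'⟩ := id hst
  refine ⟨(∫⁻ m, ENNReal.ofReal (Real.exp (2 * c * (1 + ‖m‖ ^ ((d : ℝ) + δ)))) ∂(R)).toReal,
    ENNReal.toReal_nonneg, fun Λ hm hΛ => ?_⟩
  have := isProbabilityMeasure_poissonIn z R hΛ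
  have h2 := lintegral_boltzmann_sq_le R z hz hδ hR hc hst' hΛ
  have hZ := le_partitionFunction R z hH hz hm hΛ
  set M := (∫⁻ m, ENNReal.ofReal (Real.exp (2 * c * (1 + ‖m‖ ^ ((d : ℝ) + δ)))) ∂(R)).toReal
    with hM
  have hM0 : 0 ≤ M := ENNReal.toReal_nonneg
  set V := (volume Λ).toReal with hV
  have hV0 : 0 ≤ V := ENNReal.toReal_nonneg
  set Z := partitionFunction H z R Λ hΛ with hZdef
  have hb := measurable_boltzmann hH hm hΛ
  have hZinv : Z⁻¹ ≤ ENNReal.ofReal (Real.exp (z * V)) := by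
    rw [ENNReal.inv_le_iff_inv_le, ← ENNReal.ofReal_inv_of_pos (Real.exp_pos _), ← Real.exp_neg]
    exact hZ
  -- The exponent is `2zV` from `Z⁻²` plus `zVM - zV` from the second moment.
  have h3 : ∫⁻ γ, (Z⁻¹ * boltzmann H Λ hΛ γ) ^ 2 ∂(poissonIn z R Λ) ≤
      ENNReal.ofReal (Real.exp (z * (1 + M) * V)) := by
    simp only [mul_pow]
    rw [lintegral_const_mul _ (hb.pow_const 2)]
    refine (mul_le_mul' (pow_le_pow_left' hZinv 2) h2).trans_eq ?_
    rw [← ENNReal.ofReal_pow (Real.exp_nonneg _), ← ENNReal.ofReal_mul (by positivity),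
      ← Real.exp_nat_mul, ← Real.exp_add]
    congr 2
    push_cast
    ring
  rw [gibbs_eq_withDensity R z hH hm hΛ]
  have h4 := klDiv_withDensity_le (poissonIn z R Λ) (hb.const_mul Z⁻¹)
    (lintegral_normalized_boltzmann R z hH hz hδ hR hst hm hΛ)
    (Real.one_le_exp (by positivity : 0 ≤ z * (1 + M) * V)) h3
  rwa [Real.log_exp] at h4

end Gibbs

end MarkedGibbs

theorem proposition3p3 {d : ℕ} (hd : 1 ≤ d)
    {S : Type*} [NormedAddCommGroup S] [NormedSpace ℝ S] [MeasurableSpace S] [BorelSpace S]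
    (R : Measure S) [IsProbabilityMeasure R] (z : ℝ) (hz : 0 < z)
    (δ : ℝ) (hδ : 0 < δ) (hR : MarkMoment d δ R)
    (H : FinConfig d S → EReal) (hH : IsEnergy H) (hst : IsStable δ H) :
    ∃ a₃ : ℝ, 0 < a₃ ∧ ∀ n : ℕ, 1 ≤ n →
      IsProbabilityMeasure (gibbsBar H z R n) ∧
      ∃ s : ℝ≥0∞, HasSpecificEntropy (gibbsBar H z R n) (poissonProcess d z R) s ∧
        s ≤ ENNReal.ofReal a₃ := by
  obtain ⟨M, hM0, hM⟩ := klDiv_gibbs_le R z hH hz.le hδ hR hst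
  -- Since `|Λ_n| ≥ 1`, the additive `2` in the entropy bound is absorbed into a multiple of the
  -- volume, which makes the constant independent of `n`.
  refine ⟨2 + z * (1 + M), by positivity, fun n hn => ?_⟩
  have hcube : MeasurableSet (cube d n) := measurableSet_box d _ _
  have hP := isProbabilityMeasure_gibbs R z hH hz.le hδ hR hst hcube (isBounded_cube d n)
  have hπ := isProbabilityMeasure_poissonIn z R (isBounded_cube d n)
  have hn' : (1 : ℝ) ≤ n := by exact_mod_cast hn
  have hvol : (volume (cube d n)).toReal = (2 * n : ℝ) ^ d := by
    rw [volume_cube]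
    simp
  have hV1 : (1 : ℝ) ≤ (2 * n : ℝ) ^ d := one_le_pow₀ (by linarith)
  have hI : relEntropy (cube d n) (gibbs H z R (cube d n) (isBounded_cube d n))
      (poissonIn z R (cube d n)) ≤
        ENNReal.ofReal ((2 + z * (1 + M)) * (2 * n : ℝ) ^ d) := by
    -- Restricting to the block can only lower the divergence, so the bound for the unrestricted
    -- laws is enough.
    refine (InformationTheory.klDiv_map_le
      (μ := gibbs H z R (cube d n) (isBounded_cube d n)) (ν := poissonIn z R (cube d n))
      (hg := measurable_restrict hcube)).trans ((hM _ hcube (isBounded_cube d n)).trans ?_)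
    refine ENNReal.ofReal_le_ofReal ?_
    rw [hvol]
    linarith
  have hv0 : (2 * n : ℝ≥0∞) ^ d ≠ 0 := pow_ne_zero _ (by simp; omega)
  have hvT : (2 * n : ℝ≥0∞) ^ d ≠ ∞ := ENNReal.pow_ne_top (by finiteness)
  refine ⟨⟨?_⟩, _, hasSpecificEntropy_average hd hn z R _
    (ne_top_of_le_ne_top ENNReal.ofReal_ne_top hI), ?_⟩
  · have hQ : ∀ κ : Fin d → ℤ,
        IsProbabilityMeasure ((gibbsTilde H z R n).map (MarkedGibbs.translate (latticeVec κ))) := fun κ => by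
      have : IsProbabilityMeasure (gibbsTilde H z R n) := isProbabilityMeasure_blockField _ _ _
      exact Measure.isProbabilityMeasure_map (measurable_translate _).aemeasurable
    rw [gibbsBar, Measure.smul_apply, Measure.coe_finsetSum, Finset.sum_apply]
    simp only [measure_univ, Finset.sum_const, nsmul_eq_mul, mul_one, smul_eq_mul]
    have hc := card_latticePoints d n
    rw [latticePoints] at hc
    rw [hc]
    push_cast
    exact ENNReal.inv_mul_cancel hv0 hvT
  · refine ENNReal.div_le_of_le_mul (hI.trans_eq ?_)
    rw [ENNReal.ofReal_mul (by positivity), ENNReal.ofReal_pow (by positivity),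
      ENNReal.ofReal_mul zero_le_two]
    simp
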